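/- Fix a principal ideal domain $R$. **Basic notions.** A *precubical set* $P$ is a graded set $(P_n)_{n\ge 0}$ with face operators $d^k_i\colon P_n\to P_{n-1}$ ($n>0$, $k\in\{0,1\}$, $1\le i\le n$) such that $d^k_id^l_j=d^l_{j-1}d^k_i$ for $i<j$. A path in $P$ is a finite (possibly empty) sequence of composable edges $x\in P_1$, an edge $x$ leading from $d^0_1x$ to $d^1_1x$. A *concurrent alphabet* $(\Sigma,D)$ is a set $\Sigma$ with a reflexive symmetric relation $D$; its *trace monoid* $M(\Sigma,D)$ is the quotient of the free monoid $\Sigma^*$ by the congruence generated by $ab\equiv ba$, $(a,b)\notin D$. An *HDA* $\mathcal A=(P_{\mathcal A},I_{\mathcal A},F_{\mathcal A},\Sigma_{\mathcal A},D_{\mathcal A},\lambda_{\mathcal A})$ consists of a precubical set $P_{\mathcal A}$, an initial state $I_{\mathcal A}\in (P_{\mathcal A})_0$, a (possibly empty) set of final states $F_{\mathcal A}\subseteq (P_{\mathcal A})_0$, a concurrent alphabet, and a labeling $\lambda_{\mathcal A}\colon (P_{\mathcal A})_1\to\Sigma_{\mathcal A}^*$ such that for every $x\in (P_{\mathcal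 A})_2$: $\lambda_{\mathcal A}(d^0_ix)=\lambda_{\mathcal A}(d^1_ix)$ for $i=1,2$, and for all $(a,b)\in D_{\mathcal A}$, $a$ does not occur in $\lambda_{\mathcal A}(d^0_1x)$ or $b$ does not occur in $\lambda_{\mathcal A}(d^0_2x)$. The label $\overline\lambda_{\mathcal A}(\omega)$ of a path $\omega$ is the product of the labels of its edges. $\mathcal A$ is *accessible* if every vertex is the end of a path starting in $I_{\mathcal A}$, and *coaccessible* if from every vertex there is a path to a final state. **Invariants.** The *trace language* $TL(\mathcal A)\subseteq M(\Sigma_{\mathcal A},D_{\mathcal A})$ is the set of all $v$ such that $vw=[\overline\lambda_{\mathcal A}(\omega)]$ for some $w$ and some path $\omega$ starting in $I_{\mathcal A}$. The *fundamental monoid* $\pi(\mathcal A)\subseteq M(\Sigma_{\mathcal A},D_{\mathcal A})$ is the set of all $[\overline\lambda_{\mathcal A}(\omega)]$ with $\omega$ a path from $I_{\mathcal A}$ to $I_{\mathcal A}$. Let $H_*(P)$ be the homology of the chain complex of free $R$-modules $C_n(P)=R^{(P_n)}$ with $dx=\sum_{i=1}^n(-1)^i(d^0_ix-d^1_ix)$.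 For $x\in P_n$ let $e_ix=d^0_1\cdots d^0_{i-1}d^0_{i+1}\cdots d^0_nx\in P_1$. Let $\Lambda(\Sigma)$ be the exterior algebra on the free $R$-module on $\Sigma$. The *homology language* $HL(\mathcal A)$ is the graded submodule of $\Lambda(\Sigma_{\mathcal A})$ that is the image of the map $H_*(P_{\mathcal A})\to\Lambda(\Sigma_{\mathcal A})$ induced by the chain map $C_*(P_{\mathcal A})\to\Lambda(\Sigma_{\mathcal A})$ (where $\Lambda(\Sigma_{\mathcal A})$ has zero differential) sending $x\in (P_{\mathcal A})_n$ to $$\sum_{j_1=1}^{|\lambda_{\mathcal A}(e_1x)|}\cdots\sum_{j_n=1}^{|\lambda_{\mathcal A}(e_nx)|}\lambda_{\mathcal A}(e_1x)_{j_1}\wedge\cdots\wedge\lambda_{\mathcal A}(e_nx)_{j_n}$$ (and to $1$ if $n=0$), where $m_j$ is the $j$th letter of the word $m$. **Weak implementation.** $\mathcal A\sqsubseteq\mathcal B$ ("$\mathcal A$ weakly implements $\mathcal B$") means: (1) if $\mathcal B$ is accessible, so is $\mathcal A$, and if $\mathcal B$ is coaccessible, so is $\mathcal A$; (2) $(\Sigma_{\mathcal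 A},D_{\mathcal A})=(\Sigma_{\mathcal B},D_{\mathcal B})$, $\pi(\mathcal A)\subseteq\pi(\mathcal B)$, and $TL(\mathcal A)\subseteq TL(\mathcal B)$; (3) $HL(\mathcal A)\subseteq HL(\mathcal B)$. **Constructions.** $\mathcal A\otimes\mathcal B$ has $(P_{\mathcal A}\otimes P_{\mathcal B})_n=\coprod_{p+q=n}(P_{\mathcal A})_p\times(P_{\mathcal B})_q$ with, for $(x,y)$ of bidegree $(p,q)$, $d^k_i(x,y)=(d^k_ix,y)$ for $i\le p$ and $d^k_i(x,y)=(x,d^k_{i-p}y)$ for $i>p$; initial state $(I_{\mathcal A},I_{\mathcal B})$; final states $F_{\mathcal A}\times F_{\mathcal B}$; alphabet $\Sigma_{\mathcal A}\amalg\Sigma_{\mathcal B}$, where two letters are dependent if and only if they lie in the same summand and are dependent there; and labels $\lambda(x,y)=\lambda_{\mathcal A}(x)$ if $x$ is an edge and $y$ a vertex, $\lambda(x,y)=\lambda_{\mathcal B}(y)$ if $x$ is a vertex and $y$ an edge. $\mathcal A+\mathcal B$ has the precubical subset $P_{\mathcal A}\otimes\{I_{\mathcal B}\}\cup\{I_{\mathcal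 A}\}\otimes P_{\mathcal B}$ of $P_{\mathcal A}\otimes P_{\mathcal B}$, initial state $(I_{\mathcal A},I_{\mathcal B})$, final states $F_{\mathcal A}\times\{I_{\mathcal B}\}\cup\{I_{\mathcal A}\}\times F_{\mathcal B}$, the restricted labels, and alphabet $\Sigma_{\mathcal A}\amalg\Sigma_{\mathcal B}$, where letters of the same summand are dependent if and only if they are dependent there, and letters of different summands are always dependent. **Theorem.** Let $\mathcal A,\mathcal A',\mathcal B,\mathcal B'$ be HDAs such that $\mathcal A\sqsubseteq\mathcal A'$ and $\mathcal B\sqsubseteq\mathcal B'$. Then $\mathcal A\otimes\mathcal B\sqsubseteq\mathcal A'\otimes\mathcal B'$. If $\mathcal A$ and $\mathcal B$ are coaccessible, then also $\mathcal A+\mathcal B\sqsubseteq\mathcal A'+\mathcal B'$. -/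

import Mathlib

universe u u' v v' w u₁ u₂ u₃ u₄ v₁ v₂ r

noncomputable section

/-! ## Precubical sets -/

/-- A precubical set: a graded set with face operators. Here `d k i` stands for the operator
`d^k_{i+1}` of the usual one-based numbering (`k = 0`: front faces, `k = 1`: back faces), and
`d_d` is the relation `d^k_i d^l_j = d^l_{j-1} d^k_i` for `i < j`. -/
structure PrecubicalSet where
  cube : ℕ → Type u
  d : Fin 2 → ∀ {n : ℕ}, Fin (n + 1) → cube (n + 1) → cube n
  d_d : ∀ (k l : Fin 2) {n : ℕ} (i j : Fin (n + 1)) (_ : i ≤ j) (x : cube (n + 2)),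
    d k i (d l j.succ x) = d l j (d k i.castSucc x)

namespace PrecubicalSet

/-- The face operators `P_n → P_{n-1}`, written for all `n`; the index `i : Fin n` forces `0 < n`. -/
def face (P : PrecubicalSet.{u}) (k : Fin 2) : ∀ {n : ℕ}, Fin n → P.cube n → P.cube (n - 1)
  | 0, i, _ => i.elim0
  | _ + 1, i, x => P.d k i x

/-- Precubical subsets: graded subsets stable under the face operators, as precubical sets. -/
def restrict (P : PrecubicalSet.{u}) (S : ∀ n, Set (P.cube n))
    (hS : ∀ (k : Fin 2) {n : ℕ} (i : Fin (n + 1)) (x : P.cube (n + 1)),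
      x ∈ S (n + 1) → P.d k i x ∈ S n) : PrecubicalSet.{u} where
  cube n := S n
  d k _ i x := ⟨P.d k i x.1, hS k i x.1 x.2⟩
  d_d k l _ i j h x := Subtype.ext (P.d_d k l i j h x.1)

/-- The `n`-cubes of the tensor product: the disjoint union of the `P_p × Q_q` with `p + q = n`. -/
@[ext]
structure TensorCube (P : PrecubicalSet.{u}) (Q : PrecubicalSet.{u'}) (n : ℕ) where
  p : ℕ
  q : ℕ
  add_eq : p + q = n
  fst : P.cube p
  snd : Q.cube q

/-- The face operators of the tensor product (with zero-based indices): `d^k_i (x, y)` is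
`(d^k_i x, y)` if `i < p` and `(x, d^k_{i-p} y)` if `p ≤ i`, where `x` has degree `p`. -/
def TensorCube.d {P : PrecubicalSet.{u}} {Q : PrecubicalSet.{u'}} (k : Fin 2) {n : ℕ}
    (i : Fin (n + 1)) (c : TensorCube P Q (n + 1)) : TensorCube P Q n :=
  if hi : (i : ℕ) < c.p then
    { p := c.p - 1
      q := c.q
      add_eq := by have := c.add_eq; omega
      fst := P.face k ⟨i, hi⟩ c.fst
      snd := c.snd }
  else
    { p := c.p
      q := c.q - 1
      add_eq := by have := c.add_eq; have := i.isLt; omega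
      fst := c.fst
      snd := Q.face k ⟨i - c.p, by have := c.add_eq; have := i.isLt; omega⟩ c.snd }

theorem TensorCube.d_left {P : PrecubicalSet.{u}} {Q : PrecubicalSet.{u'}} (k : Fin 2) {n p q : ℕ}
    (i : Fin (n + 1)) (j : Fin (p + 1)) (hij : (i : ℕ) = j) (h : p + 1 + q = n + 1)
    (x : P.cube (p + 1)) (y : Q.cube q) :
    TensorCube.d k i (⟨p + 1, q, h, x, y⟩ : TensorCube P Q (n + 1)) =
      ⟨p, q, by omega, P.d k j x, y⟩ := by
  have hi : (i : ℕ) < p + 1 := hij ▸ j.isLt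
  obtain rfl : (⟨i, hi⟩ : Fin (p + 1)) = j := Fin.ext hij
  exact dif_pos hi

theorem TensorCube.d_right {P : PrecubicalSet.{u}} {Q : PrecubicalSet.{u'}} (k : Fin 2) {n p q : ℕ}
    (i : Fin (n + 1)) (j : Fin (q + 1)) (hij : (i : ℕ) = p + j) (h : p + (q + 1) = n + 1)
    (x : P.cube p) (y : Q.cube (q + 1)) :
    TensorCube.d k i (⟨p, q + 1, h, x, y⟩ : TensorCube P Q (n + 1)) =
      ⟨p, q, by omega, x, Q.d k j y⟩ := by
  have hi : ¬ (i : ℕ) < p := by omega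
  have e : (⟨i - p, by omega⟩ : Fin (q + 1)) = j := Fin.ext (by simp only; omega)
  rw [← e]
  exact dif_neg hi

theorem TensorCube.d_d {P : PrecubicalSet.{u}} {Q : PrecubicalSet.{u'}} (k l : Fin 2) {n : ℕ}
    (i j : Fin (n + 1)) (hij : i ≤ j) (c : TensorCube P Q (n + 2)) :
    TensorCube.d k i (TensorCube.d l j.succ c) = TensorCube.d l j (TensorCube.d k i.castSucc c) := by
  obtain ⟨p, q, h, x, y⟩ := c
  obtain ⟨i, hi⟩ := i
  obtain ⟨j, hj⟩ := j
  simp only [Fin.mk_le_mk] at hij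
  by_cases h1 : j + 1 < p
  · obtain ⟨p, rfl⟩ : ∃ p', p = p' + 2 := ⟨p - 2, by omega⟩
    have a1 : i < p + 1 := by omega
    have a3 : j < p + 1 := by omega
    rw [d_left (p := p + 1) l (Fin.succ ⟨j, hj⟩) (Fin.succ ⟨j, a3⟩) rfl h x y,
      d_left (p := p + 1) k (Fin.castSucc ⟨i, hi⟩) (Fin.castSucc ⟨i, a1⟩) rfl h x y,
      d_left k ⟨i, hi⟩ ⟨i, a1⟩ rfl, d_left l ⟨j, hj⟩ ⟨j, a3⟩ rfl, P.d_d k l _ _ hij]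
  · by_cases h2 : i < p
    · obtain ⟨p, rfl⟩ : ∃ p', p = p' + 1 := ⟨p - 1, by omega⟩
      obtain ⟨q, rfl⟩ : ∃ q', q = q' + 1 := ⟨q - 1, by omega⟩
      have b : j - p < q + 1 := by omega
      rw [d_right l _ ⟨j - p, b⟩ (by simp only [Fin.succ_mk]; omega), d_left k ⟨i, hi⟩ ⟨i, h2⟩ rfl,
        d_left k (Fin.castSucc ⟨i, hi⟩) ⟨i, h2⟩ rfl, d_right l _ ⟨j - p, b⟩ (by simp only; omega)]
    · obtain ⟨q, rfl⟩ : ∃ q', q = q' + 2 := ⟨q - 2, by omega⟩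
      have a1 : i - p < q + 1 := by omega
      have a3 : j - p < q + 1 := by omega
      rw [d_right (q := q + 1) l _ (Fin.succ ⟨j - p, a3⟩) (by simp only [Fin.succ_mk]; omega),
        d_right (q := q + 1) k _ (Fin.castSucc ⟨i - p, a1⟩) (by simp only [Fin.castSucc_mk]; omega),
        d_right k _ ⟨i - p, a1⟩ (by simp only; omega),
        d_right l _ ⟨j - p, a3⟩ (by simp only; omega),
        Q.d_d k l _ _ (by simp only [Fin.mk_le_mk]; omega)]

/-- The tensor product of precubical sets. -/
def tensor (P : PrecubicalSet.{u}) (Q : PrecubicalSet.{u'}) : PrecubicalSet.{max u u'} where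
  cube := TensorCube P Q
  d := TensorCube.d
  d_d := TensorCube.d_d

/-- Paths from a vertex to a vertex. A path of length `l`, i.e. a morphism from the precubical
interval with vertices `0, …, l`, is a sequence of `l` composable edges. -/
inductive Path (P : PrecubicalSet.{u}) : P.cube 0 → P.cube 0 → Type u
  | nil (a : P.cube 0) : Path P a a
  | cons {a b : P.cube 0} (x : P.cube 1) (h : P.d 0 0 x = a) (ω : Path P (P.d 1 0 x) b) : Path P a b

/-- Concatenation of paths. -/
def Path.comp {P : PrecubicalSet.{u}} {c : P.cube 0} :
    ∀ {a b : P.cube 0}, Path P a b → Path P b c → Path P a c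
  | _, _, .nil _, ν => ν
  | _, _, .cons x h ω, ν => .cons x h (ω.comp ν)

/-- The starting edge `e_i x` of an `n`-cube `x` (`i` zero-based): all front faces except the one in
direction `i` are taken, in decreasing order of the directions, i.e. (one-based)
`e_i x = d^0_1 ⋯ d^0_{i-1} d^0_{i+1} ⋯ d^0_n x`. -/
def startEdge (P : PrecubicalSet.{u}) : ∀ {n : ℕ}, Fin n → P.cube n → P.cube 1
  | 0, i, _ => i.elim0
  | 1, _, x => x
  | n + 2, i, x =>
    if h : i = Fin.last (n + 1) then
      P.startEdge (Fin.last n) (P.d 0 (Fin.last n).castSucc x)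
    else P.startEdge (i.castPred h) (P.d 0 (Fin.last (n + 1)) x)

theorem startEdge_last (P : PrecubicalSet.{u}) {n : ℕ} (x : P.cube (n + 2)) :
    P.startEdge (Fin.last (n + 1)) x = P.startEdge (Fin.last n) (P.d 0 (Fin.last n).castSucc x) :=
  dif_pos rfl

theorem startEdge_castSucc (P : PrecubicalSet.{u}) {n : ℕ} (i : Fin (n + 1))
    (x : P.cube (n + 2)) :
    P.startEdge i.castSucc x = P.startEdge i (P.d 0 (Fin.last (n + 1)) x) :=
  dif_neg (Fin.castSucc_ne_last i)

theorem startEdge_d_zero (P : PrecubicalSet.{u}) : ∀ {n : ℕ} (i : Fin (n + 2)) (j : Fin (n + 1))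
    (x : P.cube (n + 2)), P.startEdge j (P.d 0 i x) = P.startEdge (i.succAbove j) x := by
  intro n
  induction n with
  | zero =>
    intro i j x
    obtain rfl : j = 0 := Fin.ext (by omega)
    fin_cases i
    · exact (P.startEdge_last x).symm
    · exact (P.startEdge_castSucc 0 x).symm
  | succ n ih =>
    intro i j x
    induction i using Fin.lastCases with
    | last => rw [Fin.succAbove_last, startEdge_castSucc]
    | cast i =>
      induction j using Fin.lastCases with
      | last =>
        rw [Fin.succAbove_of_le_castSucc _ _ (by simp [Fin.le_def]; omega), Fin.succ_last,
          startEdge_last P x]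
        induction i using Fin.lastCases with
        | last => rfl
        | cast i =>
          rw [startEdge_last, ← P.d_d 0 0 i.castSucc (Fin.last n).castSucc
            (by simp [Fin.le_def]; omega), ih,
            Fin.succAbove_of_le_castSucc _ _ (by simp [Fin.le_def]; omega), Fin.succ_last]
          rfl
      | cast j =>
        rw [show i.castSucc.succAbove j.castSucc = (i.succAbove j).castSucc from by
          simp only [Fin.succAbove, Fin.lt_def, Fin.val_castSucc]; split_ifs <;> rfl,
          startEdge_castSucc, startEdge_castSucc, ← ih,
          ← P.d_d 0 0 i (Fin.last (n + 1)) (Fin.le_last i), Fin.succ_last]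

/-! ### Cubical homology -/

/-- The module `C_n(P)` of cubical chains: the free module on the set of `n`-cubes. -/
def Chain (R : Type w) [CommRing R] (P : PrecubicalSet.{u}) (n : ℕ) : Type max u w :=
  P.cube n →₀ R

instance (R : Type w) [CommRing R] (P : PrecubicalSet.{u}) (n : ℕ) : AddCommGroup (P.Chain R n) :=
  inferInstanceAs (AddCommGroup (P.cube n →₀ R))

instance (R : Type w) [CommRing R] (P : PrecubicalSet.{u}) (n : ℕ) : Module R (P.Chain R n) :=
  inferInstanceAs (Module R (P.cube n →₀ R))

/-- The basis of `C_n(P)` formed by the `n`-cubes. -/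
def Chain.basis (R : Type w) [CommRing R] (P : PrecubicalSet.{u}) (n : ℕ) :
    Module.Basis (P.cube n) R (P.Chain R n) :=
  Module.Basis.ofRepr (LinearEquiv.refl R (P.cube n →₀ R))

/-- An `n`-cube, seen as a basis element of `C_n(P)`. -/
def Chain.of (R : Type w) [CommRing R] {P : PrecubicalSet.{u}} {n : ℕ} (x : P.cube n) :
    P.Chain R n :=
  Chain.basis R P n x

/-- The boundary operator `C_{n+1}(P) → C_n(P)`, given on cubes by
`dx = ∑ (-1)^i (d^0_i x - d^1_i x)`, where `i` is one-based in the formula. -/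
def boundary (R : Type w) [CommRing R] (P : PrecubicalSet.{u}) (n : ℕ) :
    P.Chain R (n + 1) →ₗ[R] P.Chain R n :=
  (Chain.basis R P (n + 1)).constr R fun x => ∑ i : Fin (n + 1),
    (-1 : R) ^ ((i : ℕ) + 1) • (Chain.of R (P.d 0 i x) - Chain.of R (P.d 1 i x))

theorem boundary_of (R : Type w) [CommRing R] (P : PrecubicalSet.{u}) (n : ℕ)
    (x : P.cube (n + 1)) : P.boundary R n (Chain.of R x) = ∑ i : Fin (n + 1),
    (-1 : R) ^ ((i : ℕ) + 1) • (Chain.of R (P.d 0 i x) - Chain.of R (P.d 1 i x)) :=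
  (Chain.basis R P (n + 1)).constr_basis R _ x

theorem boundary_boundary (R : Type w) [CommRing R] (P : PrecubicalSet.{u}) (n : ℕ)
    (c : P.Chain R (n + 2)) : P.boundary R n (P.boundary R (n + 1) c) = 0 := by
  suffices h : (P.boundary R n).comp (P.boundary R (n + 1)) = 0 from LinearMap.congr_fun h c
  refine (Chain.basis R P (n + 2)).ext fun x => ?_
  change P.boundary R n (P.boundary R (n + 1) (Chain.of R x)) = 0
  simp only [boundary_of, map_sum, map_smul, map_sub]
  simp only [← Finset.sum_sub_distrib, ← smul_sub, Finset.smul_sum, smul_smul]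
  rw [← Finset.sum_product', Finset.univ_product_univ]
  let S : Finset (Fin (n + 2) × Fin (n + 1)) :=
    Finset.univ.filter fun ij => (ij.1 : ℕ) ≤ (ij.2 : ℕ)
  rw [← Finset.sum_add_sum_compl S, ← eq_neg_iff_add_eq_zero, ← Finset.sum_neg_distrib]
  refine Finset.sum_bij (fun ij hij => (ij.2.succ, ij.1.castLT (by
    have := (Finset.mem_filter.mp hij).2; have := ij.2.isLt; omega))) ?_ ?_ ?_ ?_
  · rintro ⟨i, j⟩ hij
    have := (Finset.mem_filter.mp hij).2
    simp only [S, Finset.mem_compl, Finset.mem_filter, Finset.mem_univ, true_and, Fin.val_succ,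
      Fin.val_castLT] at this ⊢
    omega
  · rintro ⟨i, j⟩ hij ⟨i', j'⟩ hij' h
    simp only [Prod.mk.injEq, Fin.ext_iff, Fin.val_succ, Fin.val_castLT] at h ⊢
    omega
  · rintro ⟨i, j⟩ hij
    simp only [S, Finset.mem_compl, Finset.mem_filter, Finset.mem_univ, true_and, not_le] at hij
    refine ⟨(j.castSucc, ⟨i - 1, by have := i.isLt; omega⟩), ?_, ?_⟩
    · simp only [S, Finset.mem_filter, Finset.mem_univ, true_and, Fin.val_castSucc]
      omega
    · refine Prod.ext (Fin.ext ?_) (Fin.ext ?_)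
      · simp only [Fin.val_succ]
        omega
      · simp only [Fin.val_castLT, Fin.val_castSucc]
  · rintro ⟨i, j⟩ hij
    have hle := (Finset.mem_filter.mp hij).2
    simp only at hle
    have hi : (i : ℕ) < n + 1 := by have := j.isLt; omega
    obtain ⟨i', rfl⟩ : ∃ i' : Fin (n + 1), i = i'.castSucc := ⟨⟨i, hi⟩, rfl⟩
    have hle' : i' ≤ j := hle
    simp only [Fin.castLT_castSucc, P.d_d _ _ _ _ hle', Fin.val_succ, Fin.val_castSucc]
    rw [← neg_smul]
    have e : (-1 : R) ^ ((i' : ℕ) + 1) * (-1) ^ ((j : ℕ) + 1) =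
      -((-1) ^ ((j : ℕ) + 1 + 1) * (-1) ^ ((i' : ℕ) + 1)) := by ring
    rw [e]
    congr 1
    abel

/-- The cycles of degree `n` of the cubical chain complex. -/
def cycles (R : Type w) [CommRing R] (P : PrecubicalSet.{u}) :
    ∀ n : ℕ, Submodule R (P.Chain R n)
  | 0 => ⊤
  | n + 1 => LinearMap.ker (P.boundary R n)

theorem boundary_mem_cycles (R : Type w) [CommRing R] (P : PrecubicalSet.{u}) :
    ∀ (n : ℕ) (c : P.Chain R (n + 1)), P.boundary R n c ∈ P.cycles R n
  | 0, _ => Submodule.mem_top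
  | n + 1, c => P.boundary_boundary R n c

/-- The submodule of boundaries in the module of cycles of degree `n`. -/
def boundaries (R : Type w) [CommRing R] (P : PrecubicalSet.{u}) (n : ℕ) :
    Submodule R (P.cycles R n) :=
  LinearMap.range ((P.boundary R n).codRestrict (P.cycles R n) (P.boundary_mem_cycles R n))

/-- The cubical homology `H_n(P)` with coefficients in `R`. -/
abbrev homology (R : Type w) [CommRing R] (P : PrecubicalSet.{u}) (n : ℕ) : Type max u w :=
  P.cycles R n ⧸ P.boundaries R n

end PrecubicalSet

/-! ## Concurrent alphabets and trace monoids -/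

/-- A concurrent alphabet: a set with a reflexive and symmetric dependence relation. -/
structure ConcurrentAlphabet where
  carrier : Type v
  dep : carrier → carrier → Prop
  refl : ∀ a, dep a a
  symm : ∀ a b, dep a b → dep b a

namespace ConcurrentAlphabet

/-- The congruence on words generated by `ab ≡ ba` for independent letters `a`, `b`. -/
def traceCon (S : ConcurrentAlphabet.{v}) : Con (FreeMonoid S.carrier) :=
  conGen fun m m' => ∃ a b, ¬ S.dep a b ∧ m = FreeMonoid.of a * FreeMonoid.of b ∧
    m' = FreeMonoid.of b * FreeMonoid.of a

/-- The trace monoid of a concurrent alphabet. -/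
abbrev TraceMonoid (S : ConcurrentAlphabet.{v}) : Type v := S.traceCon.Quotient

/-- The trace represented by a word. -/
def trace (S : ConcurrentAlphabet.{v}) : FreeMonoid S.carrier →* S.TraceMonoid := S.traceCon.mk'

/-- The exterior algebra on the free module generated by the alphabet. -/
abbrev Ext (R : Type w) [CommRing R] (S : ConcurrentAlphabet.{v}) : Type max v w :=
  ExteriorAlgebra R (S.carrier →₀ R)

/-- The dependence relation of the tensor product: letters of different summands are
independent. -/
inductive TensorDep (S : ConcurrentAlphabet.{v}) (T : ConcurrentAlphabet.{v'}) :
    S.carrier ⊕ T.carrier → S.carrier ⊕ T.carrier → Prop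
  | inl {a b} : S.dep a b → TensorDep S T (.inl a) (.inl b)
  | inr {a b} : T.dep a b → TensorDep S T (.inr a) (.inr b)

/-- The dependence relation of the coproduct: letters of different summands are dependent. -/
inductive CoprodDep (S : ConcurrentAlphabet.{v}) (T : ConcurrentAlphabet.{v'}) :
    S.carrier ⊕ T.carrier → S.carrier ⊕ T.carrier → Prop
  | inl {a b} : S.dep a b → CoprodDep S T (.inl a) (.inl b)
  | inr {a b} : T.dep a b → CoprodDep S T (.inr a) (.inr b)
  | inl_inr (a b) : CoprodDep S T (.inl a) (.inr b)
  | inr_inl (a b) : CoprodDep S T (.inr a) (.inl b)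

/-- The tensor product of concurrent alphabets. -/
abbrev tensor (S : ConcurrentAlphabet.{v}) (T : ConcurrentAlphabet.{v'}) :
    ConcurrentAlphabet.{max v v'} where
  carrier := S.carrier ⊕ T.carrier
  dep := TensorDep S T
  refl
    | .inl a => .inl (S.refl a)
    | .inr a => .inr (T.refl a)
  symm
    | _, _, .inl h => .inl (S.symm _ _ h)
    | _, _, .inr h => .inr (T.symm _ _ h)

/-- The coproduct of concurrent alphabets. -/
abbrev coprod (S : ConcurrentAlphabet.{v}) (T : ConcurrentAlphabet.{v'}) :
    ConcurrentAlphabet.{max v v'} where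
  carrier := S.carrier ⊕ T.carrier
  dep := CoprodDep S T
  refl
    | .inl a => .inl (S.refl a)
    | .inr a => .inr (T.refl a)
  symm
    | _, _, .inl h => .inl (S.symm _ _ h)
    | _, _, .inr h => .inr (T.symm _ _ h)
    | _, _, .inl_inr a b => .inr_inl b a
    | _, _, .inr_inl a b => .inl_inr b a

end ConcurrentAlphabet

/-! ## Higher-dimensional automata -/

/-- A higher-dimensional automaton over a concurrent alphabet; edges are labeled by words. -/
structure HDA where
  P : PrecubicalSet.{u}
  init : P.cube 0
  final : Set (P.cube 0)
  alphabet : ConcurrentAlphabet.{v}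
  label : P.cube 1 → FreeMonoid alphabet.carrier
  label_d : ∀ (x : P.cube 2) (i : Fin 2), label (P.d 0 i x) = label (P.d 1 i x)
  label_indep : ∀ (x : P.cube 2) (a b : alphabet.carrier), alphabet.dep a b →
    a ∉ label (P.d 0 0 x) ∨ b ∉ label (P.d 0 1 x)

namespace HDA

/-! ### Labels of paths, trace language, fundamental monoid, (co)accessibility -/

/-- The extended labeling function on paths. -/
def pathLabel (A : HDA.{u, v}) :
    ∀ {a b : A.P.cube 0}, A.P.Path a b → FreeMonoid A.alphabet.carrier
  | _, _, .nil _ => 1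
  | _, _, .cons x _ ω => A.label x * A.pathLabel ω

theorem pathLabel_comp (A : HDA.{u, v}) {c : A.P.cube 0} :
    ∀ {a b : A.P.cube 0} (ω : A.P.Path a b) (ν : A.P.Path b c),
      A.pathLabel (ω.comp ν) = A.pathLabel ω * A.pathLabel ν
  | _, _, .nil _, ν => (one_mul (A.pathLabel ν)).symm
  | _, _, .cons x _ ω, ν =>
    (congrArg (A.label x * ·) (A.pathLabel_comp ω ν)).trans (mul_assoc _ _ _).symm

/-- The trace language: all prefixes of traces of paths starting in the initial state. -/
def traceLanguage (A : HDA.{u, v}) : Set A.alphabet.TraceMonoid :=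
  {m | ∃ (b : A.P.cube 0) (ω : A.P.Path A.init b) (r : A.alphabet.TraceMonoid),
    A.alphabet.trace (A.pathLabel ω) = m * r}

/-- The fundamental monoid: the traces of loops at the initial state. -/
def fundamentalMonoid (A : HDA.{u, v}) : Submonoid A.alphabet.TraceMonoid where
  carrier := {m | ∃ ω : A.P.Path A.init A.init, A.alphabet.trace (A.pathLabel ω) = m}
  one_mem' := ⟨.nil _, map_one _⟩
  mul_mem' := by
    rintro _ _ ⟨ω, rfl⟩ ⟨ν, rfl⟩
    exact ⟨ω.comp ν, by rw [pathLabel_comp, map_mul]⟩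

/-- An HDA is accessible if every state is reachable from the initial state. -/
def IsAccessible (A : HDA.{u, v}) : Prop :=
  ∀ a : A.P.cube 0, Nonempty (A.P.Path A.init a)

/-- An HDA is coaccessible if from every state there is a path to a final state. -/
def IsCoaccessible (A : HDA.{u, v}) : Prop :=
  ∀ a : A.P.cube 0, ∃ b ∈ A.final, Nonempty (A.P.Path a b)

/-! ### Labeled homology and the homology language -/

/-- The sum of all wedge products `(m_1)_{j_1} ∧ ⋯ ∧ (m_n)_{j_n}`, where `j_i` runs through the
positions of the word `m_i`. For `n = 0` this is the unit. -/
def wedge (R : Type w) [CommRing R] {S : Type v} {n : ℕ} (m : Fin n → FreeMonoid S) :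
    ExteriorAlgebra R (S →₀ R) :=
  ∑ j : (∀ i : Fin n, Fin (m i).toList.length),
    ExteriorAlgebra.ιMulti R n fun i => Finsupp.single ((m i).toList.get (j i)) 1

/-- The labeling chain map in degree `n`; an `n`-cube `x` is sent to the sum of all wedge products
`λ(e_1 x)_{j_1} ∧ ⋯ ∧ λ(e_n x)_{j_n}`. -/
def labelChain (R : Type w) [CommRing R] (A : HDA.{u, v}) (n : ℕ) :
    A.P.Chain R n →ₗ[R] A.alphabet.Ext R :=
  (PrecubicalSet.Chain.basis R A.P n).constr R fun x =>
    wedge R fun i => A.label (A.P.startEdge i x)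

theorem labelChain_of (R : Type w) [CommRing R] (A : HDA.{u, v}) {n : ℕ} (x : A.P.cube n) :
    A.labelChain R n (PrecubicalSet.Chain.of R x) =
      wedge R fun i => A.label (A.P.startEdge i x) :=
  (PrecubicalSet.Chain.basis R A.P n).constr_basis R _ x

theorem label_startEdge_d_one (A : HDA.{u, v}) : ∀ {n : ℕ} (i : Fin (n + 2)) (j : Fin (n + 1))
    (x : A.P.cube (n + 2)),
    A.label (A.P.startEdge j (A.P.d 1 i x)) = A.label (A.P.startEdge (i.succAbove j) x) := by
  intro n
  induction n with
  | zero =>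
    intro i j x
    rw [← PrecubicalSet.startEdge_d_zero]
    exact (A.label_d x i).symm
  | succ n ih =>
    intro i j x
    obtain ⟨l, hl⟩ := exists_ne j
    obtain ⟨j, rfl⟩ := Fin.exists_succAbove_eq hl.symm
    rw [← PrecubicalSet.startEdge_d_zero]
    rcases lt_or_ge (l : ℕ) i with h | h
    · obtain ⟨i, rfl⟩ : ∃ i' : Fin (n + 2), i = i'.succ :=
        ⟨⟨i - 1, by have := i.isLt; omega⟩, Fin.ext (by simp only [Fin.val_succ]; omega)⟩
      rw [A.P.d_d 0 1 l i (by simp only [Fin.le_def, Fin.val_succ] at h ⊢; omega), ih,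
        PrecubicalSet.startEdge_d_zero]
      congr 2
      simp only [Fin.val_succ] at h
      simp only [Fin.succAbove, Fin.lt_def, Fin.ext_iff]
      split_ifs <;> simp_all <;> omega
    · obtain ⟨i, rfl⟩ : ∃ i' : Fin (n + 2), i = i'.castSucc :=
        ⟨⟨i, by have := l.isLt; omega⟩, rfl⟩
      rw [← A.P.d_d 1 0 i l h, ih, PrecubicalSet.startEdge_d_zero]
      congr 2
      simp only [Fin.val_castSucc] at h
      simp only [Fin.succAbove, Fin.lt_def, Fin.ext_iff]
      split_ifs <;> simp_all <;> omega

theorem labelChain_boundary (R : Type w) [CommRing R] (A : HDA.{u, v}) (n : ℕ)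
    (c : A.P.Chain R (n + 1)) : A.labelChain R n (A.P.boundary R n c) = 0 := by
  suffices h : (A.labelChain R n).comp (A.P.boundary R n) = 0 from LinearMap.congr_fun h c
  refine (PrecubicalSet.Chain.basis R A.P (n + 1)).ext fun x => ?_
  change A.labelChain R n (A.P.boundary R n (PrecubicalSet.Chain.of R x)) = 0
  rw [PrecubicalSet.boundary_of, map_sum]
  refine Finset.sum_eq_zero fun i _ => ?_
  rw [map_smul, map_sub, labelChain_of, labelChain_of]
  have h : (fun j => A.label (A.P.startEdge j (A.P.d 0 i x))) =
      fun j => A.label (A.P.startEdge j (A.P.d 1 i x)) := by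
    funext j
    cases n with
    | zero => exact j.elim0
    | succ n => rw [A.P.startEdge_d_zero, A.label_startEdge_d_one]
  rw [h, sub_self, smul_zero]

/-- The labeling on homology, induced by the labeling chain map: `ℓ([z]) = 𝔩(z)`. -/
def labelHomology (R : Type w) [CommRing R] (A : HDA.{u, v}) (n : ℕ) :
    A.P.homology R n →ₗ[R] A.alphabet.Ext R :=
  (A.P.boundaries R n).liftQ ((A.labelChain R n).comp (A.P.cycles R n).subtype) (by
    rintro _ ⟨c, rfl⟩
    exact A.labelChain_boundary R n c)

/-- The homology language, in degree `n`: the image of the labeling on `H_n`. -/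
def homologyLanguage (R : Type w) [CommRing R] (A : HDA.{u, v}) (n : ℕ) : Submodule R (A.alphabet.Ext R) :=
  LinearMap.range (A.labelHomology R n)

/-! ### Tensor product and coproduct -/

/-- The labeling function of the tensor product: `(x, b) ↦ λ(x)` for an edge `x` and a vertex `b`,
and `(a, y) ↦ λ(y)` for a vertex `a` and an edge `y`. -/
def tensorLabel (A : HDA.{u, v}) (B : HDA.{u', v'}) :
    PrecubicalSet.TensorCube A.P B.P 1 → FreeMonoid (A.alphabet.carrier ⊕ B.alphabet.carrier)
  | ⟨1, 0, _, x, _⟩ => FreeMonoid.map Sum.inl (A.label x)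
  | ⟨0, 1, _, _, y⟩ => FreeMonoid.map Sum.inr (B.label y)
  | ⟨0, 0, h, _, _⟩ => absurd h (by omega)
  | ⟨1, _ + 1, h, _, _⟩ => absurd h (by omega)
  | ⟨0, _ + 2, h, _, _⟩ => absurd h (by omega)
  | ⟨_ + 2, _, h, _, _⟩ => absurd h (by omega)

theorem tensorLabel_d (A : HDA.{u, v}) (B : HDA.{u', v'})
    (c : PrecubicalSet.TensorCube A.P B.P 2) (i : Fin 2) :
    tensorLabel A B (c.d 0 i) = tensorLabel A B (c.d 1 i) := by
  obtain ⟨p, q, h, x, y⟩ := c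
  obtain ⟨rfl, rfl⟩ | ⟨rfl, rfl⟩ | ⟨rfl, rfl⟩ :
      (p = 2 ∧ q = 0) ∨ (p = 1 ∧ q = 1) ∨ (p = 0 ∧ q = 2) := by omega
  · rw [PrecubicalSet.TensorCube.d_left (p := 1) 0 i i rfl,
      PrecubicalSet.TensorCube.d_left (p := 1) 1 i i rfl]
    exact congrArg (FreeMonoid.map Sum.inl) (A.label_d x i)
  · fin_cases i <;> rfl
  · rw [PrecubicalSet.TensorCube.d_right (q := 1) 0 i i (Nat.zero_add _).symm,
      PrecubicalSet.TensorCube.d_right (q := 1) 1 i i (Nat.zero_add _).symm]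
    exact congrArg (FreeMonoid.map Sum.inr) (B.label_d y i)

theorem notMem_map_inl {X : Type v} {Y : Type v'} {D : X ⊕ Y → X ⊕ Y → Prop}
    {m m' : FreeMonoid X} (h : ∀ a b, D (.inl a) (.inl b) → a ∉ m ∨ b ∉ m') (s t : X ⊕ Y)
    (hst : D s t) : s ∉ FreeMonoid.map Sum.inl m ∨ t ∉ FreeMonoid.map Sum.inl m' := by
  rcases s with a | a <;> rcases t with b | b <;> simp [FreeMonoid.mem_map]
  simpa [imp_iff_not_or] using h a b hst

theorem notMem_map_inr {X : Type v} {Y : Type v'} {D : X ⊕ Y → X ⊕ Y → Prop}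
    {m m' : FreeMonoid Y} (h : ∀ a b, D (.inr a) (.inr b) → a ∉ m ∨ b ∉ m') (s t : X ⊕ Y)
    (hst : D s t) : s ∉ FreeMonoid.map Sum.inr m ∨ t ∉ FreeMonoid.map Sum.inr m' := by
  rcases s with a | a <;> rcases t with b | b <;> simp [FreeMonoid.mem_map]
  simpa [imp_iff_not_or] using h a b hst

theorem notMem_map_inr_inl {X : Type v} {Y : Type v'} {D : X ⊕ Y → X ⊕ Y → Prop}
    (m : FreeMonoid Y) (m' : FreeMonoid X) (h : ∀ b a, ¬ D (.inr b) (.inl a)) (s t : X ⊕ Y)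
    (hst : D s t) : s ∉ FreeMonoid.map Sum.inr m ∨ t ∉ FreeMonoid.map Sum.inl m' := by
  rcases s with a | a <;> rcases t with b | b <;> simp [FreeMonoid.mem_map]
  exact (h _ _ hst).elim

/-- The tensor product of HDAs. -/
def tensor (A : HDA.{u, v}) (B : HDA.{u', v'}) : HDA.{max u u', max v v'} where
  P := A.P.tensor B.P
  init := ⟨0, 0, rfl, A.init, B.init⟩
  final := {c | ∃ a ∈ A.final, ∃ b ∈ B.final, c = ⟨0, 0, rfl, a, b⟩}
  alphabet := A.alphabet.tensor B.alphabet
  label := tensorLabel A B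
  label_d := tensorLabel_d A B
  label_indep := by
    rintro ⟨p, q, h, x, y⟩
    obtain ⟨rfl, rfl⟩ | ⟨rfl, rfl⟩ | ⟨rfl, rfl⟩ :
        (p = 2 ∧ q = 0) ∨ (p = 1 ∧ q = 1) ∨ (p = 0 ∧ q = 2) := by omega
    · exact notMem_map_inl fun a b (.inl hab) => A.label_indep x a b hab
    · exact notMem_map_inr_inl _ _ fun _ _ h => nomatch h
    · exact notMem_map_inr fun a b (.inr hab) => B.label_indep y a b hab

/-- The precubical subset `P_A ⊗ {I_B} ∪ {I_A} ⊗ P_B` of `P_A ⊗ P_B`. -/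
def coprodCube (A : HDA.{u, v}) (B : HDA.{u', v'}) (n : ℕ) :
    Set ((A.P.tensor B.P).cube n) :=
  {c | (∃ x : A.P.cube n, c = ⟨n, 0, Nat.add_zero n, x, B.init⟩) ∨
    ∃ y : B.P.cube n, c = ⟨0, n, Nat.zero_add n, A.init, y⟩}

theorem d_mem_coprodCube (A : HDA.{u, v}) (B : HDA.{u', v'}) (k : Fin 2) {n : ℕ}
    (i : Fin (n + 1)) (c : (A.P.tensor B.P).cube (n + 1)) (hc : c ∈ coprodCube A B (n + 1)) :
    (A.P.tensor B.P).d k i c ∈ coprodCube A B n := by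
  rcases hc with ⟨x, rfl⟩ | ⟨y, rfl⟩
  · exact Or.inl ⟨A.P.d k i x, PrecubicalSet.TensorCube.d_left k i i rfl _ x B.init⟩
  · exact Or.inr ⟨B.P.d k i y,
      PrecubicalSet.TensorCube.d_right k i i (Nat.zero_add _).symm _ A.init y⟩

/-- The coproduct of HDAs. -/
def coprod (A : HDA.{u, v}) (B : HDA.{u', v'}) : HDA.{max u u', max v v'} where
  P := (A.P.tensor B.P).restrict (coprodCube A B) (d_mem_coprodCube A B)
  init := ⟨⟨0, 0, rfl, A.init, B.init⟩, Or.inl ⟨A.init, rfl⟩⟩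
  final := {c | (∃ a ∈ A.final, c.1 = ⟨0, 0, rfl, a, B.init⟩) ∨
    ∃ b ∈ B.final, c.1 = ⟨0, 0, rfl, A.init, b⟩}
  alphabet := A.alphabet.coprod B.alphabet
  label c := tensorLabel A B c.1
  label_d c i := tensorLabel_d A B c.1 i
  label_indep := by
    rintro ⟨_, ⟨x, rfl⟩ | ⟨y, rfl⟩⟩
    · exact notMem_map_inl fun a b (.inl hab) => A.label_indep x a b hab
    · exact notMem_map_inr fun a b (.inr hab) => B.label_indep y a b hab

/-! ### Weak implementation -/

/-- `A` weakly implements `B`, where homology is taken with coefficients in `R`. The equality of the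
concurrent alphabets is part of the condition; it is used to compare the fundamental monoids, the
trace languages, and (degreewise) the homology languages. -/
def WeaklyImplements (R : Type w) [CommRing R] (A : HDA.{u, v}) (B : HDA.{u', v}) : Prop :=
  (B.IsAccessible → A.IsAccessible) ∧ (B.IsCoaccessible → A.IsCoaccessible) ∧
  ∃ h : A.alphabet = B.alphabet,
    (h ▸ A.fundamentalMonoid : Submonoid B.alphabet.TraceMonoid) ≤ B.fundamentalMonoid ∧
    (h ▸ A.traceLanguage : Set B.alphabet.TraceMonoid) ⊆ B.traceLanguage ∧
    ∀ n, (h ▸ A.homologyLanguage R n : Submodule R (B.alphabet.Ext R)) ≤ B.homologyLanguage R n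

end HDA

end

/-! Each invariant of `A ⊗ B` and of `A + B` is a monotone expression in the invariants of `A` and
`B`; once these formulas are known, the inclusions for the factors give those for the constructions.

Traces in `A ⊗ B`: letters of different summands commute, so the trace monoid is the product of the
two trace monoids (`tensorTrace_eq`). A path in the tensor product amounts, up to trace, to a pair
of paths (`mem_traces_tensor_iff`). Hence the fundamental monoid and the trace language are given by
conditions on the two projections.

Homology language of `A ⊗ B`: it is generated by the products of elements of the two homology
languages (`homologyLanguage_tensor`). By the Künneth theorem this holds because the Tor part is
torsion and the exterior algebra is torsion-free. The proof bypasses that theorem. The boundaries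
form a free module, so a labeling `f` can be replaced by `f'`, its composite with a projection onto
the cycles. The difference `f - f'` factors through the boundary operator after extension of scalars
to the fraction field, where the target is injective (`exists_retract_on_cycles`). So `f ⊗ g` and
`f' ⊗ g'` agree on cycles (`tens_sub`), and the latter visibly takes values in the products
(`map_tens_cycles`).

Traces in `A + B`: a path can change summands only at the common initial state. So the fundamental
monoid is generated by those of `A` and `B`, and the trace of a path from the initial state is an
element of it times the trace of a path in one summand (`isCoprodTrace_of_mem_traces`). For the
trace language it remains to see that products of this shape with a last factor in a trace language
are closed under prefixes (`mem_coprodTL_of_mul_mem`); an automaton that reads a trace letter by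
letter and records the current block shows this.

Homology language of `A + B`: the precubical set is a wedge, so the homology language is the sum of
the two (`homologyLanguage_coprod`). -/

/-! ### Modules over a principal ideal domain -/

/-- Over a principal ideal domain, a submodule of `ι →₀ R` has a basis consisting of vectors whose
leading coefficients generate the ideals of all leading coefficients. -/
theorem Module.Free.submodule_finsupp_of_pid {R : Type*} [CommRing R] [IsDomain R]
    [IsPrincipalIdealRing R] {ι : Type*} (B : Submodule R (ι →₀ R)) :
    Module.Free R B := by
  classical
  let _ : LinearOrder ι := IsWellOrder.linearOrder WellOrderingRel
  have wf : WellFoundedLT ι := inferInstanceAs (IsWellFounded ι WellOrderingRel)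
  -- With the indices well-ordered, `lead i` is the ideal of coefficients at `i` of the vectors of
  -- `B` supported at indices up to `i`; `b i` realizes its generator `c i`.
  let low (i : ι) : Submodule R (ι →₀ R) := B ⊓ Finsupp.supported R R (Set.Iic i)
  let lead (i : ι) : Submodule R R := (low i).map (Finsupp.lapply i)
  let c (i : ι) : R := Submodule.IsPrincipal.generator (lead i)
  have hb (i : ι) : ∃ b ∈ low i, b i = c i := Submodule.IsPrincipal.generator_mem (lead i)
  choose b hb hbc using hb
  let κ := {i : ι // c i ≠ 0}
  let v (k : κ) : B := ⟨b k, (hb k).1⟩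
  have top (i j : ι) (h : i < j) : b i j = 0 := by
    by_contra h'
    exact absurd ((hb i).2 (Finsupp.mem_support_iff.mpr h')) (not_le.mpr h)
  have hli : LinearIndependent R v := by
    suffices h : LinearIndependent R fun k : κ => b k from LinearIndependent.of_comp B.subtype h
    rw [linearIndependent_iff]
    intro l hl
    by_contra hne
    have hs : l.support.Nonempty := Finsupp.support_nonempty_iff.mpr hne
    let m := l.support.max' hs
    have hm : m ∈ l.support := l.support.max'_mem hs
    -- At the largest index `m` of the relation only `b m` contributes, with the nonzero coefficient
    -- `c m`.
    have h := DFunLike.congr_fun hl (m : ι)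
    rw [Finsupp.linearCombination_apply, Finsupp.sum, Finsupp.finsetSum_apply] at h
    rw [Finset.sum_eq_single m] at h
    · rw [Finsupp.smul_apply, hbc, smul_eq_mul] at h
      rcases mul_eq_zero.mp h with h | h
      · exact Finsupp.mem_support_iff.mp hm h
      · exact m.2 h
    · intro k hk hkm
      have : (k : ι) < m := lt_of_le_of_ne (l.support.le_max' k hk) (fun e => hkm (Subtype.ext e))
      rw [Finsupp.smul_apply, top _ _ this, smul_zero]
    · exact fun h => absurd hm h
  have hspan (i : ι) : ∀ x ∈ low i, x ∈ (Submodule.span R (Set.range v)).map B.subtype := by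
    induction i using wf.induction with
    | ind i ih =>
      intro x hx
      -- Subtracting `r • b i` kills the coefficient at `i`, so the remainder is zero or has a
      -- smaller largest index, where the induction hypothesis applies.
      obtain ⟨r, hr⟩ := (Submodule.IsPrincipal.mem_iff_eq_smul_generator (lead i)).mp ⟨x, hx, rfl⟩
      replace hr : x i = r * c i := hr
      have hmem : r • b i ∈ (Submodule.span R (Set.range v)).map B.subtype := by
        -- If `c i = 0`, then `b i` is not one of the chosen basis vectors, but its coefficient at
        -- `i` vanishes, so the induction hypothesis covers it.
        by_cases hc : c i = 0
        · have hxi : b i ∈ (Submodule.span R (Set.range v)).map B.subtype := by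
            by_cases h0 : b i = 0
            · rw [h0]; exact zero_mem _
            · have hs := Finsupp.support_nonempty_iff.mpr h0
              have hm := (b i).support.max'_mem hs
              refine ih _ (lt_of_le_of_ne ((hb i).2 hm) fun e => ?_) _
                ⟨(hb i).1, fun j hj => (b i).support.le_max' j hj⟩
              rw [e, Finsupp.mem_support_iff, hbc] at hm
              exact hm hc
          exact Submodule.smul_mem _ _ hxi
        · exact Submodule.smul_mem _ _ ⟨v ⟨i, hc⟩, Submodule.subset_span ⟨_, rfl⟩, rfl⟩
      suffices h : x - r • b i ∈ (Submodule.span R (Set.range v)).map B.subtype by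
        simpa using add_mem h hmem
      have hy : x - r • b i ∈ low i := sub_mem hx (Submodule.smul_mem _ _ (hb i))
      have hyi : (x - r • b i) i = 0 := by simp [hr, hbc]
      generalize x - r • b i = y at hy hyi
      by_cases h0 : y = 0
      · rw [h0]; exact zero_mem _
      · have hs := Finsupp.support_nonempty_iff.mpr h0
        have hm := y.support.max'_mem hs
        refine ih _ (lt_of_le_of_ne (hy.2 hm) fun e => ?_) _
          ⟨hy.1, fun j hj => y.support.le_max' j hj⟩
        rw [e, Finsupp.mem_support_iff] at hm
        exact hm hyi
  refine Module.Free.of_basis (Module.Basis.mk hli fun x _ => ?_)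
  obtain ⟨y, hy, hyx⟩ : (x : ι →₀ R) ∈ (Submodule.span R (Set.range v)).map B.subtype := by
    by_cases h0 : (x : ι →₀ R) = 0
    · rw [h0]; exact zero_mem _
    · have hs := Finsupp.support_nonempty_iff.mpr h0
      exact hspan (x.1.support.max' hs) x ⟨x.2, fun j hj => x.1.support.le_max' j hj⟩
  rwa [← Subtype.ext hyx]

/-- Over a principal ideal domain, submodules of free modules are free. -/
theorem Module.Free.submodule_of_pid {R : Type*} [CommRing R] [IsDomain R]
    [IsPrincipalIdealRing R] {M : Type*} [AddCommGroup M] [Module R M] [Module.Free R M]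
    (B : Submodule R M) : Module.Free R B := by
  let e := Module.Free.chooseBasis R M |>.repr
  have := Module.Free.submodule_finsupp_of_pid (B.map e.toLinearMap)
  exact Module.Free.of_equiv (e.submoduleMap B).symm

/-- Vector spaces over the fraction field of a principal ideal domain satisfy Baer's criterion. -/
theorem Module.Baer.of_isFractionRing (R : Type*) [CommRing R] [IsDomain R]
    [IsPrincipalIdealRing R] (K : Type*) [Field K] [Algebra R K] [IsFractionRing R K]
    (V : Type*) [AddCommGroup V] [Module R V] [Module K V] [IsScalarTower R K V] :
    Module.Baer R V := by
  intro I g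
  obtain ⟨m, rfl⟩ := (IsPrincipalIdealRing.principal I).principal
  obtain rfl | h0 := eq_or_ne m 0
  · refine ⟨0, fun n hn => ?_⟩
    have : (⟨n, hn⟩ : Submodule.span R {(0 : R)}) = 0 := by
      rw [Submodule.span_zero_singleton] at hn
      exact Subtype.ext hn
    rw [this, map_zero, LinearMap.zero_apply]
  · let gm := g ⟨m, Submodule.subset_span (Set.mem_singleton _)⟩
    -- The ideal is generated by `m`, and the extension sends `1` to `g m / m`.
    refine ⟨LinearMap.toSpanSingleton R V ((algebraMap R K m)⁻¹ • gm), fun n hn => ?_⟩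
    obtain ⟨n, rfl⟩ := Submodule.mem_span_singleton.mp hn
    have hK : algebraMap R K m ≠ 0 := by
      simpa using h0
    rw [LinearMap.toSpanSingleton_apply, smul_assoc, ← algebraMap_smul K m, smul_inv_smul₀ hK,
      ← map_smul g, SetLike.mk_smul_mk]

/-- The exterior algebra of a free module is free. -/
instance ExteriorAlgebra.instFree {R M : Type*} [CommRing R] [AddCommGroup M] [Module R M]
    [Module.Free R M] : Module.Free R (ExteriorAlgebra R M) := by
  let _ : LinearOrder (Module.Free.ChooseBasisIndex R M) := IsWellOrder.linearOrder WellOrderingRel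
  exact Module.Free.of_basis (Module.Free.chooseBasis R M).ExteriorAlgebra

noncomputable section

/-! ### Chains on a tensor product and their cross product -/

namespace PrecubicalSet

variable (R : Type w) [CommRing R]

theorem Chain.hom_ext {P : PrecubicalSet.{u}} {n : ℕ} {M : Type*} [AddCommGroup M] [Module R M]
    {f g : P.Chain R n →ₗ[R] M} (h : ∀ x : P.cube n, f (Chain.of R x) = g (Chain.of R x)) : f = g :=
  (Chain.basis R P n).ext h

instance (P : PrecubicalSet.{u}) (n : ℕ) : Module.Free R (P.Chain R n) :=
  Module.Free.of_basis (Chain.basis R P n)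

/-- The boundary operator `C_n(P) → C_{n-1}(P)` for all `n`; it vanishes for `n = 0`. -/
def bd (P : PrecubicalSet.{u}) : ∀ n : ℕ, P.Chain R n →ₗ[R] P.Chain R (n - 1)
  | 0 => 0
  | n + 1 => P.boundary R n

theorem mem_cycles_iff (P : PrecubicalSet.{u}) : ∀ {n : ℕ} {c : P.Chain R n},
    c ∈ P.cycles R n ↔ P.bd R n c = 0
  | 0, _ => by simp [cycles, bd]
  | _ + 1, _ => Iff.rfl

theorem bd_mem_cycles (P : PrecubicalSet.{u}) : ∀ {n : ℕ} (c : P.Chain R n),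
    P.bd R n c ∈ P.cycles R (n - 1)
  | 0, _ => Submodule.mem_top
  | n + 1, c => P.boundary_mem_cycles R n c

theorem bd_of (P : PrecubicalSet.{u}) : ∀ {n : ℕ} (x : P.cube n), P.bd R n (Chain.of R x) =
    ∑ i : Fin n, (-1 : R) ^ ((i : ℕ) + 1) •
      (Chain.of R (P.face 0 i x) - Chain.of R (P.face 1 i x))
  | 0, _ => by simp [bd]
  | n + 1, x => P.boundary_of R n x

variable {P : PrecubicalSet.{u}} {Q : PrecubicalSet.{u'}}

/-- The cube `(x, y)` of a tensor product. -/
def tensorMk {n p q : ℕ} (h : p + q = n) (x : P.cube p) (y : Q.cube q) : (P.tensor Q).cube n :=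
  ⟨p, q, h, x, y⟩

theorem exists_eq_tensorMk {n : ℕ} (c : (P.tensor Q).cube n) :
    ∃ (p q : ℕ) (h : p + q = n) (x : P.cube p) (y : Q.cube q), c = tensorMk h x y :=
  ⟨c.p, c.q, c.add_eq, c.fst, c.snd, rfl⟩

/-- The first `p` directions belong to `x` and the last `q` to `y`; the shift of the numbering by
`p` produces the sign `(-1) ^ p`. -/
theorem boundary_tensorMk {n p q : ℕ} (h : p + q = n + 1) (x : P.cube p) (y : Q.cube q) :
    (P.tensor Q).boundary R n (Chain.of R (tensorMk h x y)) =
      ∑ i : Fin p, (-1 : R) ^ ((i : ℕ) + 1) •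
        (Chain.of R (tensorMk (n := n) (by have := i.isLt; omega) (P.face 0 i x) y) -
          Chain.of R (tensorMk (n := n) (by have := i.isLt; omega) (P.face 1 i x) y)) +
      (-1 : R) ^ p • ∑ j : Fin q, (-1 : R) ^ ((j : ℕ) + 1) •
        (Chain.of R (tensorMk (n := n) (by have := j.isLt; omega) x (Q.face 0 j y)) -
          Chain.of R (tensorMk (n := n) (by have := j.isLt; omega) x (Q.face 1 j y))) := by
  rw [boundary_of, ← (finCongr h).sum_comp, Fin.sum_univ_add]
  congr 1
  · refine Finset.sum_congr rfl fun i _ => ?_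
    have hd (k : Fin 2) : (P.tensor Q).d k (finCongr h (Fin.castAdd q i)) (tensorMk h x y) =
        tensorMk (by have := i.isLt; omega) (P.face k i x) y := dif_pos i.isLt
    rw [hd, hd]
    rfl
  · rw [Finset.smul_sum]
    refine Finset.sum_congr rfl fun j _ => ?_
    have hd (k : Fin 2) : (P.tensor Q).d k (finCongr h (Fin.natAdd p j)) (tensorMk h x y) =
        tensorMk (by have := j.isLt; omega) x (Q.face k j y) := by
      have hj : (⟨(finCongr h (Fin.natAdd p j) : ℕ) - p, by simp⟩ : Fin q) = j :=
        Fin.ext (by simp)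
      refine (dif_neg (by simp [tensorMk])).trans ?_
      exact congrArg (fun j => tensorMk (n := n) (by omega) x (Q.face k j y)) hj
    rw [hd, hd, smul_smul, ← pow_add]
    congr 2

/-- The linear extension of `(x, y) ↦ f x * g y` to the chains on a tensor product. -/
def tens {L : Type*} [Ring L] [Algebra R L] (f : ∀ n, P.Chain R n →ₗ[R] L)
    (g : ∀ n, Q.Chain R n →ₗ[R] L) (n : ℕ) : (P.tensor Q).Chain R n →ₗ[R] L :=
  (Chain.basis R (P.tensor Q) n).constr R fun c => f c.p (Chain.of R c.fst) * g c.q (Chain.of R c.snd)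

section tens

variable {L : Type*} [Ring L] [Algebra R L] (f : ∀ n, P.Chain R n →ₗ[R] L)
  (g : ∀ n, Q.Chain R n →ₗ[R] L)

theorem tens_tensorMk {n p q : ℕ} (h : p + q = n) (x : P.cube p) (y : Q.cube q) :
    tens R f g n (Chain.of R (tensorMk h x y)) = f p (Chain.of R x) * g q (Chain.of R y) :=
  (Chain.basis R (P.tensor Q) n).constr_basis R _ _

/-- The Leibniz rule. It needs no case distinction on `p` and `q`, because `bd` vanishes in degree
zero, where the degree `p - 1` is meaningless. -/
theorem tens_boundary_tensorMk {n p q : ℕ} (h : p + q = n + 1) (x : P.cube p) (y : Q.cube q) :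
    tens R f g n ((P.tensor Q).boundary R n (Chain.of R (tensorMk h x y))) =
      f _ (P.bd R _ (Chain.of R x)) * g _ (Chain.of R y) +
      (-1 : R) ^ p • (f _ (Chain.of R x) * g _ (Q.bd R _ (Chain.of R y))) := by
  rw [boundary_tensorMk]
  simp only [map_add, map_smul, map_sum, map_sub, tens_tensorMk, bd_of, Finset.sum_mul,
    Finset.mul_sum, smul_mul_assoc, mul_smul_comm, sub_mul, mul_sub]

end tens

/-- The cross product of chains; it is set to zero if `n ≠ p + q`. -/
def cross (P : PrecubicalSet.{u}) (Q : PrecubicalSet.{u'}) (n p q : ℕ) :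
    P.Chain R p →ₗ[R] Q.Chain R q →ₗ[R] (P.tensor Q).Chain R n :=
  (Chain.basis R P p).constr R fun x => (Chain.basis R Q q).constr R fun y =>
    if h : p + q = n then Chain.of R (tensorMk h x y) else 0

theorem cross_of_of {n p q : ℕ} (h : p + q = n) (x : P.cube p) (y : Q.cube q) :
    cross R P Q n p q (Chain.of R x) (Chain.of R y) =
      Chain.of R (tensorMk h x y) := by
  rw [cross, Chain.of, Module.Basis.constr_basis, Chain.of, Module.Basis.constr_basis, dif_pos h]

theorem boundary_cross {n p q : ℕ} (h : p + q = n + 1) (a : P.Chain R p) (b : Q.Chain R q) :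
    (P.tensor Q).boundary R n (cross R P Q (n + 1) p q a b) =
      cross R P Q n (p - 1) q (P.bd R p a) b +
        (-1 : R) ^ p • cross R P Q n p (q - 1) a (Q.bd R q b) := by
  suffices H : (cross R P Q (n + 1) p q).compr₂ ((P.tensor Q).boundary R n) =
      (cross R P Q n (p - 1) q) ∘ₗ (P.bd R p) +
        (-1 : R) ^ p • (cross R P Q n p (q - 1)).compl₂ (Q.bd R q) from
    LinearMap.congr_fun (LinearMap.congr_fun H a) b
  refine Chain.hom_ext R fun x => Chain.hom_ext R fun y => ?_
  change (P.tensor Q).boundary R n (cross R P Q (n + 1) p q (Chain.of R x) (Chain.of R y)) =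
    cross R P Q n (p - 1) q (P.bd R p (Chain.of R x)) (Chain.of R y) +
      (-1 : R) ^ p • cross R P Q n p (q - 1) (Chain.of R x) (Q.bd R q (Chain.of R y))
  rw [cross_of_of R h, boundary_tensorMk, bd_of, bd_of, map_sum, map_sum, LinearMap.sum_apply]
  congr 1
  · refine Finset.sum_congr rfl fun i _ => ?_
    have := i.isLt
    rw [map_smul, map_sub, LinearMap.smul_apply, LinearMap.sub_apply, cross_of_of R (by omega),
      cross_of_of R (by omega)]
  · congr 1
    refine Finset.sum_congr rfl fun j _ => ?_
    have := j.isLt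
    rw [map_smul, map_sub, cross_of_of R (by omega), cross_of_of R (by omega)]

theorem cross_mem_cycles {p q : ℕ} {a : P.Chain R p} {b : Q.Chain R q}
    (ha : a ∈ P.cycles R p) (hb : b ∈ Q.cycles R q) {n : ℕ} (h : p + q = n) :
    cross R P Q n p q a b ∈ (P.tensor Q).cycles R n := by
  rw [mem_cycles_iff] at ha hb
  cases n with
  | zero => exact Submodule.mem_top
  | succ n =>
    refine (boundary_cross R h a b).trans ?_
    rw [ha, hb, map_zero, map_zero, smul_zero, add_zero, LinearMap.zero_apply]

theorem tens_cross {L : Type*} [Ring L] [Algebra R L] (f : ∀ n, P.Chain R n →ₗ[R] L)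
    (g : ∀ n, Q.Chain R n →ₗ[R] L) {n p q : ℕ} (h : p + q = n) (a : P.Chain R p)
    (b : Q.Chain R q) : tens R f g n (cross R P Q n p q a b) = f p a * g q b := by
  suffices H : (cross R P Q n p q).compr₂ (tens R f g n) =
      (LinearMap.mul R L).compl₁₂ (f p) (g q) from
    LinearMap.congr_fun (LinearMap.congr_fun H a) b
  refine Chain.hom_ext R fun x => Chain.hom_ext R fun y => ?_
  rw [LinearMap.compr₂_apply, cross_of_of R h, tens_tensorMk]
  rfl

/-! ### Labels of cycles of a tensor product -/

/-- Since `f ⊗ g - f' ⊗ g' = (f - f') ⊗ g + f' ⊗ (g - g')`, the hypotheses make this difference,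
after `j`, a composite with the boundary operator. The unwanted Leibniz terms contain `g ∘ d` or `f'
∘ d` and vanish. -/
theorem tens_sub {L : Type*} [Ring L] [Algebra R L] {L' : Type*} [Ring L'] [Algebra R L']
    (j : L →ₐ[R] L') {f f' : ∀ n, P.Chain R n →ₗ[R] L}
    {g g' : ∀ n, Q.Chain R n →ₗ[R] L} {s : ∀ n, P.Chain R n →ₗ[R] L'}
    {t : ∀ n, Q.Chain R n →ₗ[R] L'}
    (hs : ∀ n c, j (f n c - f' n c) = s (n - 1) (P.bd R n c))
    (ht : ∀ n c, j (g n c - g' n c) = t (n - 1) (Q.bd R n c))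
    (hf : ∀ n c, f' (n - 1) (P.bd R n c) = 0) (hg : ∀ n c, g (n - 1) (Q.bd R n c) = 0)
    {n : ℕ} {z : (P.tensor Q).Chain R n} (hz : z ∈ (P.tensor Q).cycles R n) :
    j (tens R f g n z - tens R f' g' n z) = 0 := by
  let F := tens R s (fun m => j.toLinearMap ∘ₗ g m)
  -- The sign cancels the `(-1) ^ p` of the Leibniz rule.
  let G := tens R (fun m => (-1 : R) ^ m • j.toLinearMap ∘ₗ f' m) t
  have key : j.toLinearMap ∘ₗ (tens R f g n - tens R f' g' n) =
      (F (n - 1) + G (n - 1)) ∘ₗ (P.tensor Q).bd R n := by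
    refine Chain.hom_ext R fun c => ?_
    obtain ⟨p, q, h, x, y, rfl⟩ := exists_eq_tensorMk c
    have e (a a' b b' : L) : a * b - a' * b' = (a - a') * b + a' * (b - b') := by
      rw [sub_mul, mul_sub, sub_add_sub_cancel]
    simp only [LinearMap.comp_apply, LinearMap.sub_apply, tens_tensorMk, e, map_add,
      AlgHom.toLinearMap_apply, map_mul]
    rw [hs, ht]
    cases n with
    | zero =>
      obtain ⟨rfl, rfl⟩ : p = 0 ∧ q = 0 := by omega
      simp [bd]
    | succ n =>
      change _ = F n ((P.tensor Q).boundary R n _) + G n ((P.tensor Q).boundary R n _)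
      rw [tens_boundary_tensorMk, tens_boundary_tensorMk]
      simp [hf, hg, smul_smul, ← pow_add]
  have := LinearMap.congr_fun key z
  rw [LinearMap.comp_apply (g := (P.tensor Q).bd R n), (mem_cycles_iff R _).mp hz, map_zero] at this
  exact this

/-- A family of linear maps on the chains of a precubical set agrees on cycles with one that takes
its values in the images of the cycles, and the difference extends over the fraction field to a map
that factors through the boundary operator. -/
theorem exists_retract_on_cycles [IsDomain R] [IsPrincipalIdealRing R] {L : Type*} [Ring L]
    [Algebra R L] (P : PrecubicalSet.{u}) (f : ∀ n, P.Chain R n →ₗ[R] L) {L' : Type*} [Ring L']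
    [Algebra R L'] (hL' : Module.Baer R L') (j : L →ₐ[R] L') :
    ∃ (f' : ∀ n, P.Chain R n →ₗ[R] L) (s : ∀ n, P.Chain R n →ₗ[R] L'),
      (∀ n c, f' n c ∈ (P.cycles R n).map (f n)) ∧ (∀ n, ∀ c ∈ P.cycles R n, f' n c = f n c) ∧
      ∀ n c, j (f n c - f' n c) = s (n - 1) (P.bd R n c) := by
  have hsec (n : ℕ) : ∃ σ : LinearMap.range (P.bd R n) →ₗ[R] P.Chain R n,
      (P.bd R n).rangeRestrict ∘ₗ σ = LinearMap.id := by
    -- The image of the boundary operator is free, hence projective, so the operator has a section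
    -- `σ` over its image.
    have := Module.Free.submodule_of_pid (LinearMap.range (P.bd R n))
    exact Module.projective_lifting_property _ _ (P.bd R n).surjective_rangeRestrict
  choose σ hσ using hsec
  have hσ' (n : ℕ) (y) : P.bd R n (σ n y) = y :=
    congrArg Subtype.val (LinearMap.congr_fun (hσ n) y)
  -- The map `j ∘ f ∘ σ` is defined only on the boundaries inside `C_n`; injectivity of `L'` extends
  -- it to all of `C_n`.
  have hext (n : ℕ) : ∃ s : P.Chain R n →ₗ[R] L', s ∘ₗ (LinearMap.range (P.bd R (n + 1))).subtype =
      j.toLinearMap ∘ₗ f (n + 1) ∘ₗ σ (n + 1) :=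
    hL'.extension_property _ (Submodule.subtype_injective _) _
  choose s hs using hext
  -- The map `id - σ d` is a projection onto the cycles.
  refine ⟨fun n => f n ∘ₗ (LinearMap.id - σ n ∘ₗ (P.bd R n).rangeRestrict), s, ?_, ?_, ?_⟩
  · refine fun n c => ⟨c - σ n ((P.bd R n).rangeRestrict c), ?_, rfl⟩
    rw [SetLike.mem_coe, mem_cycles_iff, map_sub, hσ', sub_eq_zero]
    rfl
  · intro n c hc
    have : (P.bd R n).rangeRestrict c = 0 := Subtype.ext ((mem_cycles_iff R P).mp hc)
    simp [this]
  · intro n c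
    cases n with
    | zero =>
      have : (P.bd R 0).rangeRestrict c = 0 := Subtype.ext rfl
      rw [LinearMap.comp_apply, LinearMap.sub_apply, LinearMap.comp_apply, this, map_zero]
      simp [bd]
    | succ n =>
      have h := LinearMap.congr_fun (hs n) ((P.bd R (n + 1)).rangeRestrict c)
      refine Eq.trans ?_ h.symm
      simp

theorem tens_mem_iSup {L : Type*} [Ring L] [Algebra R L] {f : ∀ n, P.Chain R n →ₗ[R] L}
    {g : ∀ n, Q.Chain R n →ₗ[R] L} {U V : ℕ → Submodule R L} (hU : ∀ n c, f n c ∈ U n)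
    (hV : ∀ n c, g n c ∈ V n) {n : ℕ} (z : (P.tensor Q).Chain R n) :
    tens R f g n z ∈ ⨆ pq : {pq : ℕ × ℕ // pq.1 + pq.2 = n}, U pq.1.1 * V pq.1.2 := by
  suffices h : LinearMap.range (tens R f g n) ≤
      ⨆ pq : {pq : ℕ × ℕ // pq.1 + pq.2 = n}, U pq.1.1 * V pq.1.2 from h ⟨z, rfl⟩
  rw [tens, Module.Basis.constr_range, Submodule.span_le]
  rintro _ ⟨c, rfl⟩
  exact Submodule.mem_iSup_of_mem ⟨(c.p, c.q), c.add_eq⟩ (Submodule.mul_mem_mul (hU _ _) (hV _ _))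

/-- For chain maps to torsion-free algebras with zero differential, the image of the cycles of a
tensor product is generated by the products of images of cycles. -/
theorem map_tens_cycles [IsDomain R] [IsPrincipalIdealRing R] {L : Type*} [Ring L] [Algebra R L]
    [Module.Free R L] (f : ∀ n, P.Chain R n →ₗ[R] L) (g : ∀ n, Q.Chain R n →ₗ[R] L)
    (hf : ∀ n c, f n (P.boundary R n c) = 0) (hg : ∀ n c, g n (Q.boundary R n c) = 0) (n : ℕ) :
    ((P.tensor Q).cycles R n).map (tens R f g n) = ⨆ pq : {pq : ℕ × ℕ // pq.1 + pq.2 = n},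
      (P.cycles R pq.1.1).map (f pq.1.1) * (Q.cycles R pq.1.2).map (g pq.1.2) := by
  have hf' (n : ℕ) (c) : f (n - 1) (P.bd R n c) = 0 := by
    cases n with
    | zero => exact map_zero _
    | succ n => exact hf n c
  have hg' (n : ℕ) (c) : g (n - 1) (Q.bd R n c) = 0 := by
    cases n with
    | zero => exact map_zero _
    | succ n => exact hg n c
  apply le_antisymm
  · rintro _ ⟨z, hz, rfl⟩
    let K := FractionRing R
    -- Freeness of `L` makes `j` injective, so an equality checked over the fraction field holds in
    -- `L`.
    let j : L →ₐ[R] TensorProduct R K L := Algebra.TensorProduct.includeRight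
    have hj : Function.Injective j :=
      Algebra.TensorProduct.includeRight_injective (IsFractionRing.injective R K)
    have hB : Module.Baer R (TensorProduct R K L) := Module.Baer.of_isFractionRing R K _
    obtain ⟨f', s, hf1, hf2, hs⟩ := P.exists_retract_on_cycles R f hB j
    obtain ⟨g', t, hg1, -, ht⟩ := Q.exists_retract_on_cycles R g hB j
    -- Boundaries are cycles, on which `f'` agrees with `f`; so `f'` kills them too.
    have h := tens_sub R j hs ht (fun n c => by rw [hf2 _ _ (P.bd_mem_cycles R c), hf']) hg' hz
    rw [map_eq_zero_iff j hj, sub_eq_zero] at h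
    rw [h]
    exact tens_mem_iSup R hf1 hg1 z
  · refine iSup_le fun ⟨⟨p, q⟩, h⟩ => Submodule.mul_le.mpr ?_
    rintro _ ⟨a, ha, rfl⟩ _ ⟨b, hb, rfl⟩
    exact ⟨_, cross_mem_cycles R ha hb h, tens_cross R f g h a b⟩

end PrecubicalSet

namespace HDA

open PrecubicalSet

/-! ### The homology language of a tensor product -/

section wedge

variable (R : Type w) [CommRing R]

/-- The sum of the letters of a word, in the free module on the alphabet. -/
def letterSum {S : Type v} (m : FreeMonoid S) : S →₀ R :=
  ∑ j : Fin m.toList.length, Finsupp.single (m.toList.get j) 1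

theorem letterSum_eq_sum_map {S : Type v} (m : FreeMonoid S) :
    letterSum R m = (m.toList.map fun a => Finsupp.single a 1).sum := by
  rw [letterSum, ← List.sum_ofFn]
  exact congrArg List.sum (List.ofFn_getElem_eq_map _ fun a => Finsupp.single a 1)

theorem letterSum_map {S : Type v} {T : Type v'} (f : S → T) (m : FreeMonoid S) :
    letterSum R (FreeMonoid.map f m) = Finsupp.lmapDomain R R f (letterSum R m) := by
  rw [letterSum_eq_sum_map, letterSum_eq_sum_map, map_list_sum, FreeMonoid.toList_map, List.map_map, List.map_map]
  congr 2
  funext a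
  simp

/-- By multilinearity, the sum over all positions is a single wedge product of vectors, one for each
word. -/
theorem wedge_eq_ιMulti {S : Type v} {n : ℕ} (m : Fin n → FreeMonoid S) :
    wedge R m = ExteriorAlgebra.ιMulti R n fun i => letterSum R (m i) :=
  (MultilinearMap.map_sum (ExteriorAlgebra.ιMulti R n (M := S →₀ R)).toMultilinearMap
    fun i (j : Fin (m i).toList.length) => Finsupp.single ((m i).toList.get j) (1 : R)).symm

theorem wedge_map {S : Type v} {T : Type v'} (f : S → T) {n : ℕ} (m : Fin n → FreeMonoid S) :
    wedge R (fun i => FreeMonoid.map f (m i)) =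
      ExteriorAlgebra.map (Finsupp.lmapDomain R R f) (wedge R m) := by
  rw [wedge_eq_ιMulti, wedge_eq_ιMulti, ExteriorAlgebra.map_apply_ιMulti]
  simp only [letterSum_map]
  rfl

theorem wedge_add {S : Type v} {p q : ℕ} (m : Fin (p + q) → FreeMonoid S) :
    wedge R m = wedge R (fun i => m (Fin.castAdd q i)) * wedge R fun j => m (Fin.natAdd p j) := by
  simp only [wedge_eq_ιMulti, ExteriorAlgebra.ιMulti_apply, ← List.prod_append]
  congr 1
  rw [← List.ofFn_fin_append]
  congr 1
  funext i
  refine Fin.addCases (fun i => ?_) (fun j => ?_) i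
  · rw [Fin.append_left]
  · rw [Fin.append_right]

end wedge

/-- The faces taken in the directions of `y` reduce it to a vertex, which does not influence the
label; those taken in the directions of `x` leave its start edge. The recursion strips the highest
direction that is not kept, as `startEdge` does. -/
theorem tensorLabel_startEdge_left (A : HDA.{u, v}) (B : HDA.{u', v'}) : ∀ {n p q : ℕ}
    (h : p + q = n) (x : A.P.cube p) (y : B.P.cube q) (i : Fin n) (j : Fin p), (i : ℕ) = j →
    tensorLabel A B ((A.P.tensor B.P).startEdge i (tensorMk h x y)) =
      FreeMonoid.map Sum.inl (A.label (A.P.startEdge j x))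
  | 0, _, _, _, _, _, i, _, _ => i.elim0
  | 1, p, q, h, x, y, i, j, _ => by
    obtain ⟨rfl, rfl⟩ : p = 1 ∧ q = 0 := by have := j.isLt; omega
    rfl
  | n + 2, p, 0, h, x, y, i, j, hij => by
    obtain rfl : p = n + 2 := h
    obtain rfl : i = j := Fin.ext hij
    induction i using Fin.lastCases with
    | last =>
      rw [startEdge_last, startEdge_last]
      refine Eq.trans (congrArg (fun c => tensorLabel A B ((A.P.tensor B.P).startEdge _ c))
        (TensorCube.d_left 0 _ (Fin.last n).castSucc rfl rfl x y)) ?_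
      exact tensorLabel_startEdge_left A B _ _ y _ _ rfl
    | cast i =>
      rw [startEdge_castSucc, startEdge_castSucc]
      refine Eq.trans (congrArg (fun c => tensorLabel A B ((A.P.tensor B.P).startEdge _ c))
        (TensorCube.d_left 0 _ (Fin.last (n + 1)) rfl rfl x y)) ?_
      exact tensorLabel_startEdge_left A B _ _ y _ _ rfl
  | n + 2, p, q + 1, h, x, y, i, j, hij => by
    obtain ⟨i, rfl⟩ : ∃ i' : Fin (n + 1), i = i'.castSucc :=
      ⟨⟨i, by have := j.isLt; omega⟩, rfl⟩
    rw [startEdge_castSucc]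
    refine Eq.trans (congrArg (fun c => tensorLabel A B ((A.P.tensor B.P).startEdge _ c))
      (TensorCube.d_right 0 _ (Fin.last q) (by simp; omega) h x y)) ?_
    exact tensorLabel_startEdge_left A B _ x _ _ _ hij

theorem tensorLabel_startEdge_right (A : HDA.{u, v}) (B : HDA.{u', v'}) : ∀ {n p q : ℕ}
    (h : p + q = n) (x : A.P.cube p) (y : B.P.cube q) (i : Fin n) (j : Fin q), (i : ℕ) = p + j →
    tensorLabel A B ((A.P.tensor B.P).startEdge i (tensorMk h x y)) =
      FreeMonoid.map Sum.inr (B.label (B.P.startEdge j y))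
  | 0, _, _, _, _, _, i, _, _ => i.elim0
  | 1, p, q, h, x, y, i, j, _ => by
    obtain ⟨rfl, rfl⟩ : p = 0 ∧ q = 1 := by have := j.isLt; omega
    rfl
  | n + 2, p, 0, h, x, y, i, j, hij => j.elim0
  -- The only direction of `y` is the one kept, so the next face has to be taken in `x`.
  | n + 2, p, 1, h, x, y, i, j, hij => by
    obtain rfl : p = n + 1 := by omega
    obtain rfl : i = Fin.last (n + 1) := Fin.ext (by simp; omega)
    rw [startEdge_last]
    refine Eq.trans (congrArg (fun c => tensorLabel A B ((A.P.tensor B.P).startEdge _ c))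
      (TensorCube.d_left (n := n + 1) 0 (Fin.last n).castSucc (Fin.last n) rfl h x y)) ?_
    exact tensorLabel_startEdge_right A B _ _ y _ j (by simp)
  | n + 2, p, q + 2, h, x, y, i, j, hij => by
    induction j using Fin.lastCases with
    | last =>
      obtain rfl : i = Fin.last (n + 1) := Fin.ext (by simp at hij ⊢; omega)
      rw [startEdge_last, startEdge_last]
      refine Eq.trans (congrArg (fun c => tensorLabel A B ((A.P.tensor B.P).startEdge _ c))
        (TensorCube.d_right 0 _ (Fin.last q).castSucc (by simp; omega) h x y)) ?_
      exact tensorLabel_startEdge_right A B _ x _ _ _ (by simp; omega)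
    | cast j =>
      obtain ⟨i, rfl⟩ : ∃ i' : Fin (n + 1), i = i'.castSucc :=
        ⟨⟨i, by have := j.isLt; simp at hij; omega⟩, rfl⟩
      rw [startEdge_castSucc, startEdge_castSucc]
      refine Eq.trans (congrArg (fun c => tensorLabel A B ((A.P.tensor B.P).startEdge _ c))
        (TensorCube.d_right 0 _ (Fin.last (q + 1)) (by simp; omega) h x y)) ?_
      exact tensorLabel_startEdge_right A B _ x _ _ _ hij

section homologyLanguage

variable (R : Type w) [CommRing R]

/-- Replaces homology classes by cycles, with which all later arguments work. -/
theorem homologyLanguage_eq (A : HDA.{u, v}) (n : ℕ) :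
    A.homologyLanguage R n = (A.P.cycles R n).map (A.labelChain R n) := by
  rw [homologyLanguage, labelHomology, Submodule.range_liftQ, LinearMap.range_comp,
    Submodule.range_subtype]

/-- The inclusion of exterior algebras induced by the inclusion of the first alphabet. -/
abbrev extInl (X : Type v) (Y : Type v') :
    ExteriorAlgebra R (X →₀ R) →ₐ[R] ExteriorAlgebra R (X ⊕ Y →₀ R) :=
  ExteriorAlgebra.map (Finsupp.lmapDomain R R Sum.inl)

/-- The inclusion of exterior algebras induced by the inclusion of the second alphabet. -/
abbrev extInr (X : Type v) (Y : Type v') :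
    ExteriorAlgebra R (Y →₀ R) →ₐ[R] ExteriorAlgebra R (X ⊕ Y →₀ R) :=
  ExteriorAlgebra.map (Finsupp.lmapDomain R R Sum.inr)

theorem wedge_tensorLabel_startEdge (A : HDA.{u, v}) (B : HDA.{u', v'}) {n p q : ℕ}
    (h : p + q = n) (x : A.P.cube p) (y : B.P.cube q) :
    wedge R (fun i => tensorLabel A B ((A.P.tensor B.P).startEdge i (tensorMk h x y))) =
      extInl R A.alphabet.carrier B.alphabet.carrier
          (wedge R fun i => A.label (A.P.startEdge i x)) *
        extInr R A.alphabet.carrier B.alphabet.carrier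
          (wedge R fun i => B.label (B.P.startEdge i y)) := by
  subst h
  rw [wedge_add, ← wedge_map, ← wedge_map]
  congr 2
  · funext i
    exact tensorLabel_startEdge_left A B rfl x y _ i rfl
  · funext i
    exact tensorLabel_startEdge_right A B rfl x y _ i rfl

/-- The start edges of `(x, y)` are those of `x` followed by those of `y`, so the wedge product
splits. This brings the labeling into the form treated in `map_tens_cycles`. -/
theorem labelChain_tensor (A : HDA.{u, v}) (B : HDA.{u', v'}) (n : ℕ) :
    (A.tensor B).labelChain R n =
      tens R (fun n => (extInl R A.alphabet.carrier B.alphabet.carrier).toLinearMap ∘ₗ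
          A.labelChain R n)
        (fun n => (extInr R A.alphabet.carrier B.alphabet.carrier).toLinearMap ∘ₗ
          B.labelChain R n) n := by
  refine Chain.hom_ext R fun c => ?_
  obtain ⟨p, q, h, x, y, rfl⟩ := exists_eq_tensorMk c
  refine (labelChain_of R (A.tensor B) _).trans ((wedge_tensorLabel_startEdge R A B h x y).trans ?_)
  refine Eq.trans ?_ (tens_tensorMk R _ _ h x y).symm
  rw [LinearMap.comp_apply, LinearMap.comp_apply, labelChain_of, labelChain_of]
  rfl

/-- The degree `n` part of the graded submodule generated by the products of elements of two graded
submodules of the exterior algebras of two alphabets. -/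
def tensorHL (S : ConcurrentAlphabet.{v}) (T : ConcurrentAlphabet.{v'})
    (U : ℕ → Submodule R (S.Ext R)) (V : ℕ → Submodule R (T.Ext R)) (n : ℕ) :
    Submodule R ((S.tensor T).Ext R) :=
  ⨆ pq : {pq : ℕ × ℕ // pq.1 + pq.2 = n},
    (U pq.1.1).map (extInl R S.carrier T.carrier).toLinearMap *
      (V pq.1.2).map (extInr R S.carrier T.carrier).toLinearMap

/-- The result of `map_tens_cycles` applies because the exterior algebra of a free module is free
and the labelings kill boundaries. -/
theorem homologyLanguage_tensor [IsDomain R] [IsPrincipalIdealRing R] (A : HDA.{u, v})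
    (B : HDA.{u', v'}) (n : ℕ) : (A.tensor B).homologyLanguage R n =
      tensorHL R A.alphabet B.alphabet (A.homologyLanguage R) (B.homologyLanguage R) n := by
  rw [homologyLanguage_eq, labelChain_tensor]
  refine (map_tens_cycles R
    (fun n => (extInl R A.alphabet.carrier B.alphabet.carrier).toLinearMap ∘ₗ A.labelChain R n)
    (fun n => (extInr R A.alphabet.carrier B.alphabet.carrier).toLinearMap ∘ₗ B.labelChain R n)
    (fun n c => ?_) (fun n c => ?_) n).trans ?_
  · rw [LinearMap.comp_apply, labelChain_boundary, map_zero]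
  · rw [LinearMap.comp_apply, labelChain_boundary, map_zero]
  · simp only [tensorHL, homologyLanguage_eq, Submodule.map_comp]

end homologyLanguage

end HDA

/-! ### Morphisms of precubical sets and projections of chains -/

namespace PrecubicalSet

/-- Morphisms of precubical sets. -/
structure Hom (P : PrecubicalSet.{u}) (Q : PrecubicalSet.{u'}) where
  toFun : ∀ {n : ℕ}, P.cube n → Q.cube n
  map_d : ∀ (k : Fin 2) {n : ℕ} (i : Fin (n + 1)) (x : P.cube (n + 1)),
    toFun (P.d k i x) = Q.d k i (toFun x)

namespace Hom

variable {P : PrecubicalSet.{u}} {Q : PrecubicalSet.{u'}} (φ : Hom P Q)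

theorem startEdge_map : ∀ {n : ℕ} (i : Fin n) (x : P.cube n),
    Q.startEdge i (φ.toFun x) = φ.toFun (P.startEdge i x)
  | 0, i, _ => i.elim0
  | 1, _, _ => rfl
  | n + 2, i, x => by
    induction i using Fin.lastCases with
    | last => rw [startEdge_last, startEdge_last, ← map_d, startEdge_map]
    | cast i => rw [startEdge_castSucc, startEdge_castSucc, ← map_d, startEdge_map]

variable (R : Type w) [CommRing R]

/-- The chain map induced by a morphism of precubical sets. -/
def chain (n : ℕ) : P.Chain R n →ₗ[R] Q.Chain R n :=
  (Chain.basis R P n).constr R fun x => Chain.of R (φ.toFun x)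

theorem chain_of {n : ℕ} (x : P.cube n) :
    φ.chain R n (Chain.of R x) = Chain.of R (φ.toFun x) :=
  (Chain.basis R P n).constr_basis R _ x

theorem boundary_chain {n : ℕ} (c : P.Chain R (n + 1)) :
    Q.boundary R n (φ.chain R (n + 1) c) = φ.chain R n (P.boundary R n c) := by
  suffices h : Q.boundary R n ∘ₗ φ.chain R (n + 1) = φ.chain R n ∘ₗ P.boundary R n from
    LinearMap.congr_fun h c
  refine Chain.hom_ext R fun x => ?_
  simp only [LinearMap.comp_apply, chain_of, boundary_of, map_sum, map_smul, map_sub, map_d]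

theorem chain_mem_cycles : ∀ {n : ℕ} {c : P.Chain R n}, c ∈ P.cycles R n →
    φ.chain R n c ∈ Q.cycles R n
  | 0, _, _ => Submodule.mem_top
  | n + 1, c, hc => by
    refine (φ.boundary_chain R c).trans ?_
    rw [show P.boundary R n c = 0 from hc, map_zero]

end Hom

/-- The inclusion of a precubical subset. -/
def restrictHom (P : PrecubicalSet.{u}) (S : ∀ n, Set (P.cube n))
    (hS : ∀ (k : Fin 2) {n : ℕ} (i : Fin (n + 1)) (x : P.cube (n + 1)),
      x ∈ S (n + 1) → P.d k i x ∈ S n) : Hom (P.restrict S hS) P where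
  toFun x := x.1
  map_d _ _ _ _ := rfl

/-- The inclusion `x ↦ (x, b)` for a vertex `b`. -/
def tensorInl (P : PrecubicalSet.{u}) {Q : PrecubicalSet.{u'}} (b : Q.cube 0) :
    Hom P (P.tensor Q) where
  toFun x := tensorMk rfl x b
  map_d k _ i x := (TensorCube.d_left k i i rfl rfl x b).symm

/-- The inclusion `y ↦ (a, y)` for a vertex `a`. -/
def tensorInr {P : PrecubicalSet.{u}} (Q : PrecubicalSet.{u'}) (a : P.cube 0) :
    Hom Q (P.tensor Q) where
  toFun y := tensorMk (Nat.zero_add _) a y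
  map_d k _ i y := (TensorCube.d_right k i i (Nat.zero_add _).symm (Nat.zero_add _) a y).symm

section projections

variable (R : Type w) [CommRing R] (P : PrecubicalSet.{u}) (Q : PrecubicalSet.{u'})

/-- The projection of chains `C_*(P ⊗ Q) → C_*(P)`; it annihilates `(x, y)` if `y` is not a
vertex. -/
def chainFst (n : ℕ) : (P.tensor Q).Chain R n →ₗ[R] P.Chain R n :=
  (Chain.basis R (P.tensor Q) n).constr R fun c =>
    if h : c.p = n then Chain.of R (h ▸ c.fst : P.cube n) else 0

/-- The projection of chains `C_*(P ⊗ Q) → C_*(Q)`; it annihilates `(x, y)` if `x` is not a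
vertex. -/
def chainSnd (n : ℕ) : (P.tensor Q).Chain R n →ₗ[R] Q.Chain R n :=
  (Chain.basis R (P.tensor Q) n).constr R fun c =>
    if h : c.q = n then Chain.of R (h ▸ c.snd : Q.cube n) else 0

variable {P Q}

theorem chainFst_tensorMk {n : ℕ} (h : n + 0 = n) (x : P.cube n) (y : Q.cube 0) :
    chainFst R P Q n (Chain.of R (tensorMk h x y)) = Chain.of R x :=
  ((Chain.basis R (P.tensor Q) n).constr_basis R _ _).trans (dif_pos rfl)

theorem chainFst_tensorMk_eq_zero {n p q : ℕ} (h : p + q = n) (hp : p ≠ n) (x : P.cube p)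
    (y : Q.cube q) : chainFst R P Q n (Chain.of R (tensorMk h x y)) = 0 :=
  ((Chain.basis R (P.tensor Q) n).constr_basis R _ _).trans (dif_neg hp)

theorem chainSnd_tensorMk {n : ℕ} (h : 0 + n = n) (x : P.cube 0) (y : Q.cube n) :
    chainSnd R P Q n (Chain.of R (tensorMk h x y)) = Chain.of R y :=
  ((Chain.basis R (P.tensor Q) n).constr_basis R _ _).trans (dif_pos rfl)

theorem chainSnd_tensorMk_eq_zero {n p q : ℕ} (h : p + q = n) (hq : q ≠ n) (x : P.cube p)
    (y : Q.cube q) : chainSnd R P Q n (Chain.of R (tensorMk h x y)) = 0 :=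
  ((Chain.basis R (P.tensor Q) n).constr_basis R _ _).trans (dif_neg hq)

/-- The only delicate case is that of an edge `y`: the cube `(x, y)` projects to zero, while its
faces `(x, d^0 y)` and `(x, d^1 y)` both project to `x` and cancel. If `y` has degree at least two,
every face projects to zero. -/
theorem boundary_chainFst {n : ℕ} (c : (P.tensor Q).Chain R (n + 1)) :
    P.boundary R n (chainFst R P Q (n + 1) c) =
      chainFst R P Q n ((P.tensor Q).boundary R n c) := by
  suffices h : P.boundary R n ∘ₗ chainFst R P Q (n + 1) =
      chainFst R P Q n ∘ₗ (P.tensor Q).boundary R n from LinearMap.congr_fun h c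
  refine Chain.hom_ext R fun c => ?_
  obtain ⟨p, q, h, x, y, rfl⟩ := exists_eq_tensorMk c
  rw [LinearMap.comp_apply, LinearMap.comp_apply, boundary_tensorMk]
  match q with
  | 0 =>
    obtain rfl : p = n + 1 := h
    rw [chainFst_tensorMk, boundary_of, Finset.univ_eq_empty (α := Fin 0), Finset.sum_empty,
      smul_zero, add_zero, map_sum]
    refine Finset.sum_congr rfl fun i _ => ?_
    rw [map_smul, map_sub]
    exact congrArg _ (congrArg₂ _ (chainFst_tensorMk R _ _ _).symm
      (chainFst_tensorMk R _ _ _).symm)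
  | 1 =>
    obtain rfl : p = n := by omega
    rw [chainFst_tensorMk_eq_zero R h (by omega), map_zero, map_add, map_sum,
      Finset.sum_eq_zero, zero_add, map_smul, map_sum, Finset.sum_eq_zero, smul_zero]
    · intro j _
      rw [map_smul, map_sub]
      refine (congrArg _ (sub_eq_zero.mpr ?_)).trans (smul_zero _)
      exact (chainFst_tensorMk R _ _ _).trans (chainFst_tensorMk R _ _ _).symm
    · intro i _
      rw [map_smul, map_sub, chainFst_tensorMk_eq_zero R _ (by have := i.isLt; omega),
        chainFst_tensorMk_eq_zero R _ (by have := i.isLt; omega), sub_zero, smul_zero]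
  | q + 2 =>
    rw [chainFst_tensorMk_eq_zero R h (by omega), map_zero, map_add, map_sum,
      Finset.sum_eq_zero, zero_add, map_smul, map_sum, Finset.sum_eq_zero, smul_zero]
    · intro j _
      rw [map_smul, map_sub, chainFst_tensorMk_eq_zero R _ (by omega),
        chainFst_tensorMk_eq_zero R _ (by omega), sub_zero, smul_zero]
    · intro i _
      rw [map_smul, map_sub, chainFst_tensorMk_eq_zero R _ (by omega),
        chainFst_tensorMk_eq_zero R _ (by omega), sub_zero, smul_zero]

theorem boundary_chainSnd {n : ℕ} (c : (P.tensor Q).Chain R (n + 1)) :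
    Q.boundary R n (chainSnd R P Q (n + 1) c) =
      chainSnd R P Q n ((P.tensor Q).boundary R n c) := by
  suffices h : Q.boundary R n ∘ₗ chainSnd R P Q (n + 1) =
      chainSnd R P Q n ∘ₗ (P.tensor Q).boundary R n from LinearMap.congr_fun h c
  refine Chain.hom_ext R fun c => ?_
  obtain ⟨p, q, h, x, y, rfl⟩ := exists_eq_tensorMk c
  rw [LinearMap.comp_apply, LinearMap.comp_apply, boundary_tensorMk]
  match p with
  | 0 =>
    obtain rfl : q = n + 1 := by omega
    rw [chainSnd_tensorMk, boundary_of, Finset.univ_eq_empty (α := Fin 0), Finset.sum_empty,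
      pow_zero, one_smul, zero_add, map_sum]
    refine Finset.sum_congr rfl fun i _ => ?_
    rw [map_smul, map_sub]
    exact congrArg _ (congrArg₂ _ (chainSnd_tensorMk R _ _ _).symm
      (chainSnd_tensorMk R _ _ _).symm)
  | 1 =>
    obtain rfl : q = n := by omega
    rw [chainSnd_tensorMk_eq_zero R h (by omega), map_zero, map_add, map_sum,
      Finset.sum_eq_zero, zero_add, map_smul, map_sum, Finset.sum_eq_zero, smul_zero]
    · intro j _
      rw [map_smul, map_sub, chainSnd_tensorMk_eq_zero R _ (by have := j.isLt; omega),
        chainSnd_tensorMk_eq_zero R _ (by have := j.isLt; omega), sub_zero, smul_zero]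
    · intro i _
      rw [map_smul, map_sub]
      refine (congrArg _ (sub_eq_zero.mpr ?_)).trans (smul_zero _)
      exact (chainSnd_tensorMk R _ _ _).trans (chainSnd_tensorMk R _ _ _).symm
  | p + 2 =>
    rw [chainSnd_tensorMk_eq_zero R h (by omega), map_zero, map_add, map_sum,
      Finset.sum_eq_zero, zero_add, map_smul, map_sum, Finset.sum_eq_zero, smul_zero]
    · intro j _
      rw [map_smul, map_sub, chainSnd_tensorMk_eq_zero R _ (by omega),
        chainSnd_tensorMk_eq_zero R _ (by omega), sub_zero, smul_zero]
    · intro i _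
      rw [map_smul, map_sub, chainSnd_tensorMk_eq_zero R _ (by omega),
        chainSnd_tensorMk_eq_zero R _ (by omega), sub_zero, smul_zero]

end projections

end PrecubicalSet

namespace HDA

open PrecubicalSet

/-! ### The homology language of a coproduct -/

/-- The inclusion of the first summand of a coproduct. -/
def coprodInl (A : HDA.{u, v}) (B : HDA.{u', v'}) : Hom A.P (A.coprod B).P where
  toFun x := ⟨tensorMk rfl x B.init, Or.inl ⟨x, rfl⟩⟩
  map_d k _ i x := Subtype.ext ((tensorInl A.P B.init).map_d k i x)

/-- The inclusion of the second summand of a coproduct. -/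
def coprodInr (A : HDA.{u, v}) (B : HDA.{u', v'}) : Hom B.P (A.coprod B).P where
  toFun y := ⟨tensorMk (Nat.zero_add _) A.init y, Or.inr ⟨y, rfl⟩⟩
  map_d k _ i y := Subtype.ext ((tensorInr B.P A.init).map_d k i y)

section

variable (R : Type w) [CommRing R]

theorem labelChain_map (A : HDA.{u, v}) (B : HDA.{u', v'}) (φ : Hom A.P B.P)
    (f : A.alphabet.carrier → B.alphabet.carrier)
    (hf : ∀ x, B.label (φ.toFun x) = FreeMonoid.map f (A.label x)) {n : ℕ} (c : A.P.Chain R n) :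
    B.labelChain R n (φ.chain R n c) =
      ExteriorAlgebra.map (Finsupp.lmapDomain R R f) (A.labelChain R n c) := by
  suffices h : B.labelChain R n ∘ₗ φ.chain R n =
      (ExteriorAlgebra.map (Finsupp.lmapDomain R R f)).toLinearMap ∘ₗ A.labelChain R n from
    LinearMap.congr_fun h c
  refine Chain.hom_ext R fun x => ?_
  rw [LinearMap.comp_apply, LinearMap.comp_apply, Hom.chain_of, labelChain_of, labelChain_of,
    AlgHom.toLinearMap_apply, ← wedge_map]
  simp only [Hom.startEdge_map, hf]

theorem map_homologyLanguage_le (A : HDA.{u, v}) (B : HDA.{u', v'}) (φ : Hom A.P B.P)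
    (f : A.alphabet.carrier → B.alphabet.carrier)
    (hf : ∀ x, B.label (φ.toFun x) = FreeMonoid.map f (A.label x)) (n : ℕ) :
    (A.homologyLanguage R n).map (ExteriorAlgebra.map (Finsupp.lmapDomain R R f)).toLinearMap ≤
      B.homologyLanguage R n := by
  rw [homologyLanguage_eq, homologyLanguage_eq]
  rintro _ ⟨_, ⟨c, hc, rfl⟩, rfl⟩
  exact ⟨φ.chain R n c, φ.chain_mem_cycles R hc, labelChain_map R A B φ f hf c⟩

/-- The degree `n` part of the graded submodule generated by two graded submodules of the exterior
algebras of two alphabets. -/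
def coprodHL (S : ConcurrentAlphabet.{v}) (T : ConcurrentAlphabet.{v'})
    (U : ℕ → Submodule R (S.Ext R)) (V : ℕ → Submodule R (T.Ext R)) (n : ℕ) :
    Submodule R ((S.coprod T).Ext R) :=
  (U n).map (extInl R S.carrier T.carrier).toLinearMap ⊔
    (V n).map (extInr R S.carrier T.carrier).toLinearMap

theorem labelChain_zero_of (A : HDA.{u, v}) (x : A.P.cube 0) :
    A.labelChain R 0 (Chain.of R x) = 1 := by
  rw [labelChain_of, wedge_eq_ιMulti, ExteriorAlgebra.ιMulti_zero_apply]

/-- The labeling chain map of a coproduct. -/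
def labelChainCoprod (A : HDA.{u, v}) (B : HDA.{u', v'}) (n : ℕ) :
    (A.coprod B).P.Chain R n →ₗ[R]
      ExteriorAlgebra R (A.alphabet.carrier ⊕ B.alphabet.carrier →₀ R) :=
  (A.coprod B).labelChain R n

theorem labelChainCoprod_inl (A : HDA.{u, v}) (B : HDA.{u', v'}) {n : ℕ} (x : A.P.cube n) :
    labelChainCoprod R A B n (Chain.of R ((coprodInl A B).toFun x)) =
      extInl R A.alphabet.carrier B.alphabet.carrier (A.labelChain R n (Chain.of R x)) := by
  rw [← Hom.chain_of]
  exact labelChain_map R A (A.coprod B) (coprodInl A B) Sum.inl (fun _ => rfl) (Chain.of R x)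

theorem labelChainCoprod_inr (A : HDA.{u, v}) (B : HDA.{u', v'}) {n : ℕ} (y : B.P.cube n) :
    labelChainCoprod R A B n (Chain.of R ((coprodInr A B).toFun y)) =
      extInr R A.alphabet.carrier B.alphabet.carrier (B.labelChain R n (Chain.of R y)) := by
  rw [← Hom.chain_of]
  exact labelChain_map R B (A.coprod B) (coprodInr A B) Sum.inr (fun _ => rfl) (Chain.of R y)

/-- The inclusion of a coproduct in the tensor product. -/
def coprodIncl (A : HDA.{u, v}) (B : HDA.{u', v'}) : Hom (A.coprod B).P (A.P.tensor B.P) :=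
  restrictHom _ _ (d_mem_coprodCube A B)

/-- In positive degree every cube of the coproduct lies in exactly one summand and is killed by the
other projection. In degree zero both projections of a vertex would contribute a unit, so that
degree is excluded. -/
theorem labelChainCoprod_succ (A : HDA.{u, v}) (B : HDA.{u', v'}) {n : ℕ}
    (z : (A.coprod B).P.Chain R (n + 1)) :
    labelChainCoprod R A B (n + 1) z =
      extInl R A.alphabet.carrier B.alphabet.carrier (A.labelChain R (n + 1)
        (chainFst R A.P B.P (n + 1) ((coprodIncl A B).chain R (n + 1) z))) +
      extInr R A.alphabet.carrier B.alphabet.carrier (B.labelChain R (n + 1)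
        (chainSnd R A.P B.P (n + 1) ((coprodIncl A B).chain R (n + 1) z))) := by
  suffices key : labelChainCoprod R A B (n + 1) =
      (extInl R A.alphabet.carrier B.alphabet.carrier).toLinearMap ∘ₗ A.labelChain R (n + 1) ∘ₗ
          chainFst R A.P B.P (n + 1) ∘ₗ (coprodIncl A B).chain R (n + 1) +
        (extInr R A.alphabet.carrier B.alphabet.carrier).toLinearMap ∘ₗ B.labelChain R (n + 1) ∘ₗ
          chainSnd R A.P B.P (n + 1) ∘ₗ (coprodIncl A B).chain R (n + 1) from
    LinearMap.congr_fun key z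
  refine Chain.hom_ext R fun c => ?_
  simp only [LinearMap.add_apply, LinearMap.comp_apply, Hom.chain_of, AlgHom.toLinearMap_apply]
  obtain ⟨_, ⟨x, rfl⟩ | ⟨y, rfl⟩⟩ := c
  · refine (labelChainCoprod_inl R A B x).trans ?_
    have h1 : chainFst R A.P B.P (n + 1) (Chain.of R ((coprodIncl A B).toFun
        ((coprodInl A B).toFun x))) = Chain.of R x := chainFst_tensorMk R _ x B.init
    have h2 : chainSnd R A.P B.P (n + 1) (Chain.of R ((coprodIncl A B).toFun
        ((coprodInl A B).toFun x))) = 0 := chainSnd_tensorMk_eq_zero R _ (by omega) x B.init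
    refine ((congrArg₂ (fun c c' => extInl R _ _ (A.labelChain R (n + 1) c) +
      extInr R _ _ (B.labelChain R (n + 1) c')) h1 h2).trans ?_).symm
    rw [map_zero, map_zero, add_zero]
  · refine (labelChainCoprod_inr R A B y).trans ?_
    have h1 : chainFst R A.P B.P (n + 1) (Chain.of R ((coprodIncl A B).toFun
        ((coprodInr A B).toFun y))) = 0 :=
      chainFst_tensorMk_eq_zero R (Nat.zero_add _) (by omega) A.init y
    have h2 : chainSnd R A.P B.P (n + 1) (Chain.of R ((coprodIncl A B).toFun
        ((coprodInr A B).toFun y))) = Chain.of R y := chainSnd_tensorMk R _ A.init y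
    refine ((congrArg₂ (fun c c' => extInl R _ _ (A.labelChain R (n + 1) c) +
      extInr R _ _ (B.labelChain R (n + 1) c')) h1 h2).trans ?_).symm
    rw [map_zero, map_zero, zero_add]

theorem map_labelChainCoprod_cycles_le (A : HDA.{u, v}) (B : HDA.{u', v'}) (n : ℕ) :
    ((A.coprod B).P.cycles R n).map (labelChainCoprod R A B n) ≤
      (A.homologyLanguage R n).map
          (extInl R A.alphabet.carrier B.alphabet.carrier).toLinearMap ⊔
        (B.homologyLanguage R n).map
          (extInr R A.alphabet.carrier B.alphabet.carrier).toLinearMap := by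
  rw [homologyLanguage_eq, homologyLanguage_eq]
  cases n with
  | zero =>
    refine Submodule.map_le_iff_le_comap.mpr fun z _ => ?_
    suffices h : ⊤ ≤ Submodule.comap (labelChainCoprod R A B 0) _ from h Submodule.mem_top
    rw [← (Chain.basis R (A.coprod B).P 0).span_eq, Submodule.span_le]
    rintro _ ⟨x, rfl⟩
    have hx : labelChainCoprod R A B 0 (Chain.basis R (A.coprod B).P 0 x) = 1 :=
      labelChain_zero_of R (A.coprod B) x
    rw [SetLike.mem_coe, Submodule.mem_comap, hx]
    -- All vertices are labeled by the unit, which the initial state of `A` already provides.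
    exact Submodule.mem_sup_left ⟨1, ⟨_, Submodule.mem_top, labelChain_zero_of R A A.init⟩,
      map_one (extInl R A.alphabet.carrier B.alphabet.carrier)⟩
  | succ n =>
    rintro _ ⟨z, hz, rfl⟩
    have hz' : (A.P.tensor B.P).boundary R n _ = 0 := (coprodIncl A B).chain_mem_cycles R hz
    rw [labelChainCoprod_succ]
    -- The two projections are chain maps, so both components of a cycle are cycles.
    refine Submodule.add_mem_sup ⟨_, ⟨_, ?_, rfl⟩, rfl⟩ ⟨_, ⟨_, ?_, rfl⟩, rfl⟩
    · refine (boundary_chainFst R _).trans ?_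
      rw [hz', map_zero]
    · refine (boundary_chainSnd R _).trans ?_
      rw [hz', map_zero]

theorem homologyLanguage_coprod (A : HDA.{u, v}) (B : HDA.{u', v'}) (n : ℕ) :
    (A.coprod B).homologyLanguage R n =
      coprodHL R A.alphabet B.alphabet (A.homologyLanguage R) (B.homologyLanguage R) n := by
  apply le_antisymm
  · rw [homologyLanguage_eq]
    exact map_labelChainCoprod_cycles_le R A B n
  · exact sup_le
      (map_homologyLanguage_le R A (A.coprod B) (coprodInl A B) Sum.inl (fun _ => rfl) n)
      (map_homologyLanguage_le R B (A.coprod B) (coprodInr A B) Sum.inr (fun _ => rfl) n)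

end

end HDA

/-! ### The universal property of trace monoids -/

namespace ConcurrentAlphabet

section lift

variable (S : ConcurrentAlphabet.{v})

/-- The trace of a single letter. -/
def letter (a : S.carrier) : S.TraceMonoid := S.trace (FreeMonoid.of a)

theorem letter_comm {a b : S.carrier} (h : ¬ S.dep a b) :
    S.letter a * S.letter b = S.letter b * S.letter a :=
  (Con.eq _).mpr (ConGen.Rel.of _ _ ⟨a, b, h, rfl, rfl⟩)

/-- The universal property of the trace monoid. -/
def lift {N : Type*} [Monoid N] (f : S.carrier → N)
    (hf : ∀ a b, ¬ S.dep a b → f a * f b = f b * f a) : S.TraceMonoid →* N :=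
  S.traceCon.lift (FreeMonoid.lift f) (Con.conGen_le.mpr (by
    rintro _ _ ⟨a, b, h, rfl, rfl⟩
    rw [Con.ker_rel, map_mul, map_mul, FreeMonoid.lift_eval_of, FreeMonoid.lift_eval_of]
    exact hf a b h))

theorem lift_letter {N : Type*} [Monoid N] (f : S.carrier → N)
    (hf : ∀ a b, ¬ S.dep a b → f a * f b = f b * f a) (a : S.carrier) :
    S.lift f hf (S.letter a) = f a :=
  (Con.lift_mk' _ _).trans (FreeMonoid.lift_eval_of f a)

theorem trace_surjective : Function.Surjective S.trace := Con.mk'_surjective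

variable {S}

theorem trace_hom_ext {N : Type*} [Monoid N] {f g : S.TraceMonoid →* N}
    (h : ∀ a, f (S.letter a) = g (S.letter a)) : f = g := by
  refine (MonoidHom.cancel_right S.trace_surjective).mp ?_
  exact FreeMonoid.hom_eq h

theorem trace_induction {p : S.TraceMonoid → Prop} (one : p 1)
    (mul : ∀ a m, p m → p (S.letter a * m)) (m : S.TraceMonoid) : p m := by
  obtain ⟨m, rfl⟩ := S.trace_surjective m
  induction m using FreeMonoid.inductionOn' with
  | one => rwa [map_one]
  | of_mul a m ih => rw [map_mul]; exact mul a _ ih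

end lift

/-! ### Traces over a tensor product of alphabets -/

section tensor

variable (S : ConcurrentAlphabet.{v}) (T : ConcurrentAlphabet.{v'})

/-- The inclusion of the first trace monoid. -/
def tensorTraceInl : S.TraceMonoid →* (S.tensor T).TraceMonoid :=
  S.lift (fun a => (S.tensor T).letter (.inl a)) fun _ _ h =>
    (S.tensor T).letter_comm fun h' => by cases h' with | inl h' => exact h h'

/-- The inclusion of the second trace monoid. -/
def tensorTraceInr : T.TraceMonoid →* (S.tensor T).TraceMonoid :=
  T.lift (fun a => (S.tensor T).letter (.inr a)) fun _ _ h =>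
    (S.tensor T).letter_comm fun h' => by cases h' with | inr h' => exact h h'

/-- The projection to the first trace monoid. -/
def tensorTraceFst : (S.tensor T).TraceMonoid →* S.TraceMonoid :=
  (S.tensor T).lift (Sum.elim S.letter fun _ => 1) (by
    rintro (a | a) (b | b) h
    · exact S.letter_comm fun h' => h (.inl h')
    all_goals simp)

/-- The projection to the second trace monoid. -/
def tensorTraceSnd : (S.tensor T).TraceMonoid →* T.TraceMonoid :=
  (S.tensor T).lift (Sum.elim (fun _ => 1) T.letter) (by
    rintro (a | a) (b | b) h
    on_goal 4 => exact T.letter_comm fun h' => h (.inr h')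
    all_goals simp)

variable {S T}

theorem tensorTraceInl_letter (a : S.carrier) :
    tensorTraceInl S T (S.letter a) = (S.tensor T).letter (.inl a) := lift_letter _ _ _ _

theorem tensorTraceInr_letter (a : T.carrier) :
    tensorTraceInr S T (T.letter a) = (S.tensor T).letter (.inr a) := lift_letter _ _ _ _

theorem tensorTraceFst_inl_letter (a : S.carrier) :
    tensorTraceFst S T ((S.tensor T).letter (.inl a)) = S.letter a := lift_letter _ _ _ _

theorem tensorTraceFst_inr_letter (a : T.carrier) :
    tensorTraceFst S T ((S.tensor T).letter (.inr a)) = 1 := lift_letter _ _ _ _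

theorem tensorTraceSnd_inl_letter (a : S.carrier) :
    tensorTraceSnd S T ((S.tensor T).letter (.inl a)) = 1 := lift_letter _ _ _ _

theorem tensorTraceSnd_inr_letter (a : T.carrier) :
    tensorTraceSnd S T ((S.tensor T).letter (.inr a)) = T.letter a := lift_letter _ _ _ _

theorem tensorTraceFst_inl (u : S.TraceMonoid) : tensorTraceFst S T (tensorTraceInl S T u) = u := by
  refine DFunLike.congr_fun (trace_hom_ext (f := (tensorTraceFst S T).comp (tensorTraceInl S T))
    (g := .id _) fun a => ?_) u
  rw [MonoidHom.comp_apply, tensorTraceInl_letter, tensorTraceFst_inl_letter, MonoidHom.id_apply]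

theorem tensorTraceSnd_inr (u : T.TraceMonoid) : tensorTraceSnd S T (tensorTraceInr S T u) = u := by
  refine DFunLike.congr_fun (trace_hom_ext (f := (tensorTraceSnd S T).comp (tensorTraceInr S T))
    (g := .id _) fun a => ?_) u
  rw [MonoidHom.comp_apply, tensorTraceInr_letter, tensorTraceSnd_inr_letter, MonoidHom.id_apply]

theorem tensorTraceFst_inr (u : T.TraceMonoid) : tensorTraceFst S T (tensorTraceInr S T u) = 1 := by
  refine DFunLike.congr_fun (trace_hom_ext (f := (tensorTraceFst S T).comp (tensorTraceInr S T))
    (g := 1) fun a => ?_) u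
  rw [MonoidHom.comp_apply, tensorTraceInr_letter, tensorTraceFst_inr_letter, MonoidHom.one_apply]

theorem tensorTraceSnd_inl (u : S.TraceMonoid) : tensorTraceSnd S T (tensorTraceInl S T u) = 1 := by
  refine DFunLike.congr_fun (trace_hom_ext (f := (tensorTraceSnd S T).comp (tensorTraceInl S T))
    (g := 1) fun a => ?_) u
  rw [MonoidHom.comp_apply, tensorTraceInl_letter, tensorTraceSnd_inl_letter, MonoidHom.one_apply]

theorem tensorTrace_commute (u : S.TraceMonoid) (w : T.TraceMonoid) :
    Commute (tensorTraceInl S T u) (tensorTraceInr S T w) := by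
  induction u using trace_induction with
  | one => rw [map_one]; exact Commute.one_left _
  | mul a u hu =>
    rw [map_mul]
    refine Commute.mul_left ?_ hu
    clear hu
    induction w using trace_induction with
    | one => rw [map_one]; exact Commute.one_right _
    | mul b w hw =>
      rw [map_mul]
      refine Commute.mul_right ?_ hw
      rw [tensorTraceInl_letter, tensorTraceInr_letter]
      exact (S.tensor T).letter_comm nofun

/-- The letters of the second alphabet can be moved to the right past those of the first, so a trace
is determined by its two projections. -/
theorem tensorTrace_eq (m : (S.tensor T).TraceMonoid) :
    tensorTraceInl S T (tensorTraceFst S T m) * tensorTraceInr S T (tensorTraceSnd S T m) = m := by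
  induction m using trace_induction with
  | one => simp only [map_one, mul_one]
  | mul a m ih =>
    rcases a with a | a
    · rw [map_mul (tensorTraceFst S T), map_mul (tensorTraceSnd S T), tensorTraceFst_inl_letter,
        tensorTraceSnd_inl_letter, map_mul, tensorTraceInl_letter, one_mul, mul_assoc, ih]
    · rw [map_mul (tensorTraceFst S T), map_mul (tensorTraceSnd S T), tensorTraceFst_inr_letter,
        tensorTraceSnd_inr_letter, one_mul, map_mul, ← mul_assoc, (tensorTrace_commute _ _).eq, tensorTraceInr_letter, mul_assoc, ih]

variable (S T)

/-- The submonoid of traces whose projections lie in given submonoids. -/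
def tensorFM (M : Submonoid S.TraceMonoid) (N : Submonoid T.TraceMonoid) :
    Submonoid (S.tensor T).TraceMonoid :=
  M.comap (tensorTraceFst S T) ⊓ N.comap (tensorTraceSnd S T)

/-- The language of traces whose projections lie in given trace languages. -/
def tensorTL (X : Set S.TraceMonoid) (Y : Set T.TraceMonoid) : Set (S.tensor T).TraceMonoid :=
  {m | tensorTraceFst S T m ∈ X ∧ tensorTraceSnd S T m ∈ Y}

end tensor

/-! ### Traces over a coproduct of alphabets -/

section coprod

variable (S : ConcurrentAlphabet.{v}) (T : ConcurrentAlphabet.{v'})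

/-- The inclusion of the first trace monoid. -/
def coprodTraceInl : S.TraceMonoid →* (S.coprod T).TraceMonoid :=
  S.lift (fun a => (S.coprod T).letter (.inl a)) fun _ _ h =>
    (S.coprod T).letter_comm fun h' => by cases h' with | inl h' => exact h h'

/-- The inclusion of the second trace monoid. -/
def coprodTraceInr : T.TraceMonoid →* (S.coprod T).TraceMonoid :=
  T.lift (fun a => (S.coprod T).letter (.inr a)) fun _ _ h =>
    (S.coprod T).letter_comm fun h' => by cases h' with | inr h' => exact h h'

/-- The submonoid generated by submonoids of the two trace monoids. -/
def coprodFM (M : Submonoid S.TraceMonoid) (N : Submonoid T.TraceMonoid) :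
    Submonoid (S.coprod T).TraceMonoid :=
  M.map (coprodTraceInl S T) ⊔ N.map (coprodTraceInr S T)

/-- The traces that are products of an element of the submonoid generated by two submonoids and an
element of one of two trace languages. -/
def coprodTL (M : Submonoid S.TraceMonoid) (N : Submonoid T.TraceMonoid) (X : Set S.TraceMonoid)
    (Y : Set T.TraceMonoid) : Set (S.coprod T).TraceMonoid :=
  {m | ∃ n ∈ coprodFM S T M N,
    (∃ t ∈ X, m = n * coprodTraceInl S T t) ∨ ∃ t ∈ Y, m = n * coprodTraceInr S T t}

variable {S T}

theorem coprodTraceInl_letter (a : S.carrier) :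
    coprodTraceInl S T (S.letter a) = (S.coprod T).letter (.inl a) := lift_letter _ _ _ _

theorem coprodTraceInr_letter (a : T.carrier) :
    coprodTraceInr S T (T.letter a) = (S.coprod T).letter (.inr a) := lift_letter _ _ _ _

variable (M : Submonoid S.TraceMonoid) (N : Submonoid T.TraceMonoid)

open Classical in
/-- The transition function of an automaton that reads traces over a coproduct of alphabets and
remembers the last block of letters of the same summand; it fails when a block that is not in the
given submonoid ends. -/
def blockStep : S.carrier ⊕ T.carrier → Function.End (Option (S.TraceMonoid ⊕ T.TraceMonoid))
  | .inl a, some (.inl t) => some (.inl (t * S.letter a))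
  | .inl a, some (.inr t) => if t ∈ N then some (.inl (S.letter a)) else none
  | .inr a, some (.inr t) => some (.inr (t * T.letter a))
  | .inr a, some (.inl t) => if t ∈ M then some (.inr (T.letter a)) else none
  | _, none => none

/-- Independent letters belong to the same summand, since letters of different summands are
dependent. So both extend the same block, or the first one read opens a block and the other extends
it, or the run fails in either order. -/
theorem blockStep_comm {a b : S.carrier ⊕ T.carrier} (h : ¬ (S.coprod T).dep a b)
    (s : Option (S.TraceMonoid ⊕ T.TraceMonoid)) :
    blockStep M N b (blockStep M N a s) = blockStep M N a (blockStep M N b s) := by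
  rcases a with a | a <;> rcases b with b | b
  · have hab := S.letter_comm fun h' => h (.inl h')
    rcases s with _ | t | t
    · rfl
    · simp only [blockStep, mul_assoc, hab]
    · simp only [blockStep]
      split_ifs
      · simp only [hab]
      · rfl
  · exact absurd (.inl_inr a b) h
  · exact absurd (.inr_inl a b) h
  · have hab := T.letter_comm fun h' => h (.inr h')
    rcases s with _ | t | t
    · rfl
    · simp only [blockStep]
      split_ifs
      · simp only [hab]
      · rfl
    · simp only [blockStep, mul_assoc, hab]

/-- The action of the traces over a coproduct of alphabets on the states of the block automaton. -/
def blockRun :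
    (S.coprod T).TraceMonoid →* (Function.End (Option (S.TraceMonoid ⊕ T.TraceMonoid)))ᵐᵒᵖ :=
  -- Reading from left to right is a right action, hence the opposite monoid.
  (S.coprod T).lift (fun a => .op (blockStep M N a)) fun _ _ h =>
    congrArg MulOpposite.op (funext fun s => blockStep_comm M N h s)

/-- The state of the block automaton after reading a trace. -/
def blockState (m : (S.coprod T).TraceMonoid) (s : Option (S.TraceMonoid ⊕ T.TraceMonoid)) :
    Option (S.TraceMonoid ⊕ T.TraceMonoid) :=
  (blockRun M N m).unop s

variable {M N}

theorem blockState_one (s) : blockState M N 1 s = s := by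
  rw [blockState, map_one]; rfl

theorem blockState_mul (m n : (S.coprod T).TraceMonoid) (s) :
    blockState M N (m * n) s = blockState M N n (blockState M N m s) := by
  rw [blockState, map_mul]; rfl

theorem blockState_letter (a : S.carrier ⊕ T.carrier) (s) :
    blockState M N ((S.coprod T).letter a) s = blockStep M N a s := by
  rw [blockState, blockRun, lift_letter]; rfl

theorem blockState_inl_inl (u t : S.TraceMonoid) :
    blockState M N (coprodTraceInl S T u) (some (.inl t)) = some (.inl (t * u)) := by
  induction u using trace_induction generalizing t with
  | one => rw [map_one, blockState_one, mul_one]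
  | mul a u ih =>
    rw [map_mul, blockState_mul, coprodTraceInl_letter, blockState_letter]
    exact (ih _).trans (by rw [mul_assoc])

theorem blockState_inr_inr (u t : T.TraceMonoid) :
    blockState M N (coprodTraceInr S T u) (some (.inr t)) = some (.inr (t * u)) := by
  induction u using trace_induction generalizing t with
  | one => rw [map_one, blockState_one, mul_one]
  | mul a u ih =>
    rw [map_mul, blockState_mul, coprodTraceInr_letter, blockState_letter]
    exact (ih _).trans (by rw [mul_assoc])

/-- The first letter of a nonempty `u` closes the block `t`, which is allowed by `ht`, and the new
block absorbs the rest. The empty trace closes nothing, whence the first alternative. -/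
theorem blockState_inl_inr (u : S.TraceMonoid) {t : T.TraceMonoid} (ht : t ∈ N) :
    (u = 1 ∧ blockState M N (coprodTraceInl S T u) (some (.inr t)) = some (.inr t)) ∨
      blockState M N (coprodTraceInl S T u) (some (.inr t)) = some (.inl u) := by
  induction u using trace_induction with
  | one => exact .inl ⟨rfl, by rw [map_one, blockState_one]⟩
  | mul a u _ =>
    refine .inr ?_
    rw [map_mul, blockState_mul, coprodTraceInl_letter, blockState_letter]
    exact (congrArg _ (if_pos ht)).trans (blockState_inl_inl u _)

theorem blockState_inr_inl (u : T.TraceMonoid) {t : S.TraceMonoid} (ht : t ∈ M) :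
    (u = 1 ∧ blockState M N (coprodTraceInr S T u) (some (.inl t)) = some (.inl t)) ∨
      blockState M N (coprodTraceInr S T u) (some (.inl t)) = some (.inr u) := by
  induction u using trace_induction with
  | one => exact .inl ⟨rfl, by rw [map_one, blockState_one]⟩
  | mul a u _ =>
    refine .inr ?_
    rw [map_mul, blockState_mul, coprodTraceInr_letter, blockState_letter]
    exact (congrArg _ (if_pos ht)).trans (blockState_inr_inr u _)

/-- The states of the block automaton whose block belongs to one of two sets. -/
def blockStates (X : Set S.TraceMonoid) (Y : Set T.TraceMonoid) :
    Set (Option (S.TraceMonoid ⊕ T.TraceMonoid)) :=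
  {s | (∃ t ∈ X, s = some (.inl t)) ∨ ∃ t ∈ Y, s = some (.inr t)}

/-- The traces that preserve this set of states form a submonoid, so it suffices to check the two
generating submonoids. -/
theorem blockState_mem_of_mem {n : (S.coprod T).TraceMonoid} (hn : n ∈ coprodFM S T M N) {s}
    (hs : s ∈ blockStates (M : Set S.TraceMonoid) (N : Set T.TraceMonoid)) :
    blockState M N n s ∈ blockStates (M : Set S.TraceMonoid) (N : Set T.TraceMonoid) := by
  let Z : Submonoid (S.coprod T).TraceMonoid :=
    { carrier := {n | ∀ s ∈ blockStates (M : Set S.TraceMonoid) (N : Set T.TraceMonoid),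
        blockState M N n s ∈ blockStates (M : Set S.TraceMonoid) (N : Set T.TraceMonoid)}
      one_mem' := fun s hs => by rwa [blockState_one]
      mul_mem' := fun hm hn s hs => by rw [blockState_mul]; exact hn _ (hm s hs) }
  suffices h : coprodFM S T M N ≤ Z from h hn s hs
  refine sup_le ?_ ?_
  · rintro _ ⟨u, hu, rfl⟩ _ (⟨t, ht, rfl⟩ | ⟨t, ht, rfl⟩)
    · exact .inl ⟨_, M.mul_mem ht hu, blockState_inl_inl u t⟩
    · rcases blockState_inl_inr u ht with ⟨-, h⟩ | h
      · exact .inr ⟨t, ht, h⟩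
      · exact .inl ⟨u, hu, h⟩
  · rintro _ ⟨u, hu, rfl⟩ _ (⟨t, ht, rfl⟩ | ⟨t, ht, rfl⟩)
    · rcases blockState_inr_inl u ht with ⟨-, h⟩ | h
      · exact .inl ⟨t, ht, h⟩
      · exact .inr ⟨u, hu, h⟩
    · exact .inr ⟨_, N.mul_mem ht hu, blockState_inr_inr u t⟩

/-- After the factor from the submonoid, the block lies in `M` or `N`. The last factor extends it,
as in `hX` and `hY`, or replaces it, or is trivial and leaves it unchanged; the last case needs
`hMX` and `hNY`. -/
theorem blockState_mem_of_mem_coprodTL {X : Set S.TraceMonoid} {Y : Set T.TraceMonoid}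
    (hX : ∀ m ∈ M, ∀ t ∈ X, m * t ∈ X) (hY : ∀ n ∈ N, ∀ t ∈ Y, n * t ∈ Y)
    (hMX : ∀ m ∈ M, m ∈ X) (hNY : ∀ n ∈ N, n ∈ Y) {m : (S.coprod T).TraceMonoid}
    (hm : m ∈ coprodTL S T M N X Y) :
    blockState M N m (some (.inl 1)) ∈ blockStates X Y := by
  obtain ⟨n, hn, h⟩ := hm
  have hs := blockState_mem_of_mem hn (s := some (.inl 1)) (.inl ⟨1, M.one_mem, rfl⟩)
  rcases h with ⟨u, hu, rfl⟩ | ⟨u, hu, rfl⟩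
  · rw [blockState_mul]
    rcases hs with ⟨t, ht, h⟩ | ⟨t, ht, h⟩
    · exact .inl ⟨_, hX t ht u hu, by rw [h, blockState_inl_inl]⟩
    · rw [h]
      rcases blockState_inl_inr u ht with ⟨-, h⟩ | h
      · exact .inr ⟨t, hNY t ht, h⟩
      · exact .inl ⟨u, hu, h⟩
  · rw [blockState_mul]
    rcases hs with ⟨t, ht, h⟩ | ⟨t, ht, h⟩
    · rw [h]
      rcases blockState_inr_inl u ht with ⟨-, h⟩ | h
      · exact .inl ⟨t, hMX t ht, h⟩
      · exact .inr ⟨u, hu, h⟩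
    · exact .inr ⟨_, hY t ht u hu, by rw [h, blockState_inr_inr]⟩

/-- Going back by one letter: the previous block is either a prefix of the present one or was
closed, and only blocks in `M` or `N` can be closed without failure. -/
theorem mem_blockStates_of_blockState_mem {X : Set S.TraceMonoid} {Y : Set T.TraceMonoid}
    (hX : ∀ m r, m * r ∈ X → m ∈ X) (hY : ∀ m r, m * r ∈ Y → m ∈ Y)
    (hMX : ∀ m ∈ M, m ∈ X) (hNY : ∀ n ∈ N, n ∈ Y) (r : (S.coprod T).TraceMonoid) (s)
    (h : blockState M N r s ∈ blockStates X Y) : s ∈ blockStates X Y := by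
  induction r using trace_induction generalizing s with
  | one => rwa [blockState_one] at h
  | mul a r ih =>
    rw [blockState_mul, blockState_letter] at h
    replace h := ih _ h
    rcases a with a | a <;> rcases s with _ | t | t
    · rcases h with ⟨_, _, h⟩ | ⟨_, _, h⟩ <;> cases h
    · rcases h with ⟨t', ht', h⟩ | ⟨_, _, h⟩ <;> cases h
      exact .inl ⟨t, hX _ _ ht', rfl⟩
    · by_cases ht : t ∈ N
      · exact .inr ⟨t, hNY t ht, rfl⟩
      · rw [blockStep, if_neg ht] at h
        rcases h with ⟨_, _, h⟩ | ⟨_, _, h⟩ <;> cases h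
    · rcases h with ⟨_, _, h⟩ | ⟨_, _, h⟩ <;> cases h
    · by_cases ht : t ∈ M
      · exact .inl ⟨t, hMX t ht, rfl⟩
      · rw [blockStep, if_neg ht] at h
        rcases h with ⟨_, _, h⟩ | ⟨_, _, h⟩ <;> cases h
    · rcases h with ⟨_, _, h⟩ | ⟨t', ht', h⟩ <;> cases h
      exact .inr ⟨t, hY _ _ ht', rfl⟩

variable (M N) in
/-- A trace is the product of an element of the submonoid generated by two submonoids and the block
of a state of the block automaton. -/
def IsBlockOf (m : (S.coprod T).TraceMonoid) : Option (S.TraceMonoid ⊕ T.TraceMonoid) → Prop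
  | some (.inl t) => ∃ n ∈ coprodFM S T M N, m = n * coprodTraceInl S T t
  | some (.inr t) => ∃ n ∈ coprodFM S T M N, m = n * coprodTraceInr S T t
  | none => True

/-- A block that is closed without failure belongs to `M` or `N` and is absorbed by the factor in
the generated submonoid. Nothing is claimed about the failure state. -/
theorem IsBlockOf.blockState (r : (S.coprod T).TraceMonoid) {m s} (h : IsBlockOf M N m s) :
    IsBlockOf M N (m * r) (blockState M N r s) := by
  induction r using trace_induction generalizing m s with
  | one => rwa [blockState_one, mul_one]
  | mul a r ih =>
    rw [blockState_mul, blockState_letter, ← mul_assoc]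
    refine ih ?_
    rcases a with a | a <;> rcases s with _ | t | t
    · trivial
    · obtain ⟨n, hn, rfl⟩ := h
      exact ⟨n, hn, by rw [map_mul, coprodTraceInl_letter, mul_assoc]⟩
    · rw [blockStep]
      split_ifs with ht
      · obtain ⟨n, hn, rfl⟩ := h
        refine ⟨_, mul_mem hn ?_, by rw [coprodTraceInl_letter]⟩
        exact Submonoid.mem_sup_right ⟨t, ht, rfl⟩
      · trivial
    · trivial
    · rw [blockStep]
      split_ifs with ht
      · obtain ⟨n, hn, rfl⟩ := h
        refine ⟨_, mul_mem hn ?_, by rw [coprodTraceInr_letter]⟩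
        exact Submonoid.mem_sup_left ⟨t, ht, rfl⟩
      · trivial
    · obtain ⟨n, hn, rfl⟩ := h
      exact ⟨n, hn, by rw [map_mul, coprodTraceInr_letter, mul_assoc]⟩

/-- A factorization of `m * r` need not be compatible with the cut after `m`, but the automaton
reads `m` first. Acceptance of `m * r` forces acceptance of the state reached after `m`, and the
invariant `IsBlockOf` turns that state into a factorization of `m`. -/
theorem mem_coprodTL_of_mul_mem {X : Set S.TraceMonoid} {Y : Set T.TraceMonoid}
    (hX : ∀ m r, m * r ∈ X → m ∈ X) (hY : ∀ m r, m * r ∈ Y → m ∈ Y)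
    (hX' : ∀ m ∈ M, ∀ t ∈ X, m * t ∈ X) (hY' : ∀ n ∈ N, ∀ t ∈ Y, n * t ∈ Y)
    (hMX : ∀ m ∈ M, m ∈ X) (hNY : ∀ n ∈ N, n ∈ Y) {m r : (S.coprod T).TraceMonoid}
    (h : m * r ∈ coprodTL S T M N X Y) : m ∈ coprodTL S T M N X Y := by
  have hs := blockState_mem_of_mem_coprodTL hX' hY' hMX hNY h
  rw [blockState_mul] at hs
  replace hs := mem_blockStates_of_blockState_mem hX hY hMX hNY r _ hs
  -- The run starts with an empty block, attributed by convention to the first summand.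
  have hm := IsBlockOf.blockState (M := M) (N := N) (m := 1) (s := some (.inl 1)) m
    ⟨1, one_mem _, by rw [map_one, mul_one]⟩
  rw [one_mul] at hm
  rcases hs with ⟨t, ht, hs⟩ | ⟨t, ht, hs⟩ <;> rw [hs] at hm <;> obtain ⟨n, hn, hm⟩ := hm
  · exact ⟨n, hn, .inl ⟨t, ht, hm⟩⟩
  · exact ⟨n, hn, .inr ⟨t, ht, hm⟩⟩

end coprod

end ConcurrentAlphabet

/-! ### Vertices and edges of a tensor product -/

namespace PrecubicalSet

variable {P : PrecubicalSet.{u}} {Q : PrecubicalSet.{u'}}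

/-- The first component of a vertex of a tensor product. -/
def vertexFst (c : (P.tensor Q).cube 0) : P.cube 0 :=
  (show c.p = 0 by have := c.add_eq; omega) ▸ c.fst

/-- The second component of a vertex of a tensor product. -/
def vertexSnd (c : (P.tensor Q).cube 0) : Q.cube 0 :=
  (show c.q = 0 by have := c.add_eq; omega) ▸ c.snd

theorem tensorMk_vertex (c : (P.tensor Q).cube 0) :
    tensorMk rfl (vertexFst c) (vertexSnd c) = c := by
  obtain ⟨p, q, h, x, y, rfl⟩ := exists_eq_tensorMk c
  obtain ⟨rfl, rfl⟩ : p = 0 ∧ q = 0 := by omega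
  rfl

theorem exists_eq_tensorMk_one (c : (P.tensor Q).cube 1) :
    (∃ x b, c = tensorMk (p := 1) (q := 0) rfl x b) ∨
      ∃ a y, c = tensorMk (p := 0) (q := 1) rfl a y := by
  obtain ⟨p, q, h, x, y, rfl⟩ := exists_eq_tensorMk c
  obtain ⟨rfl, rfl⟩ | ⟨rfl, rfl⟩ : (p = 1 ∧ q = 0) ∨ (p = 0 ∧ q = 1) := by omega
  · exact .inl ⟨x, y, rfl⟩
  · exact .inr ⟨x, y, rfl⟩

end PrecubicalSet

namespace HDA

open PrecubicalSet ConcurrentAlphabet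

/-! ### Traces of paths -/

/-- The traces of the paths between two vertices. -/
def traces (A : HDA.{u, v}) (a b : A.P.cube 0) : Set A.alphabet.TraceMonoid :=
  Set.range fun ω : A.P.Path a b => A.alphabet.trace (A.pathLabel ω)

theorem one_mem_traces (A : HDA.{u, v}) (a : A.P.cube 0) : 1 ∈ A.traces a a :=
  ⟨.nil a, map_one _⟩

theorem mul_mem_traces {A : HDA.{u, v}} {a b c : A.P.cube 0} {m n : A.alphabet.TraceMonoid}
    (hm : m ∈ A.traces a b) (hn : n ∈ A.traces b c) : m * n ∈ A.traces a c := by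
  obtain ⟨ω, rfl⟩ := hm
  obtain ⟨ν, rfl⟩ := hn
  exact ⟨ω.comp ν, by simp only [pathLabel_comp, map_mul]⟩

theorem label_mem_traces (A : HDA.{u, v}) (x : A.P.cube 1) :
    A.alphabet.trace (A.label x) ∈ A.traces (A.P.d 0 0 x) (A.P.d 1 0 x) :=
  ⟨.cons x rfl (.nil _), congrArg A.alphabet.trace (mul_one _)⟩

theorem mem_traceLanguage_iff {A : HDA.{u, v}} {m : A.alphabet.TraceMonoid} :
    m ∈ A.traceLanguage ↔ ∃ b r, m * r ∈ A.traces A.init b := by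
  constructor
  · rintro ⟨b, ω, r, h⟩
    exact ⟨b, r, ω, h⟩
  · rintro ⟨b, r, ω, h⟩
    exact ⟨b, ω, r, h⟩

theorem mem_traceLanguage_of_mem_traces {A : HDA.{u, v}} {b} {m : A.alphabet.TraceMonoid}
    (h : m ∈ A.traces A.init b) : m ∈ A.traceLanguage :=
  mem_traceLanguage_iff.mpr ⟨b, 1, by rwa [mul_one]⟩

theorem mem_traceLanguage_of_mul_mem {A : HDA.{u, v}} (m r : A.alphabet.TraceMonoid)
    (h : m * r ∈ A.traceLanguage) : m ∈ A.traceLanguage := by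
  obtain ⟨b, r', h⟩ := mem_traceLanguage_iff.mp h
  exact mem_traceLanguage_iff.mpr ⟨b, r * r', by rwa [← mul_assoc]⟩

theorem mul_mem_traceLanguage {A : HDA.{u, v}} (m) (hm : m ∈ A.fundamentalMonoid) (t)
    (ht : t ∈ A.traceLanguage) : m * t ∈ A.traceLanguage := by
  obtain ⟨b, r, h⟩ := mem_traceLanguage_iff.mp ht
  exact mem_traceLanguage_iff.mpr ⟨b, r, by rw [mul_assoc]; exact mul_mem_traces hm h⟩

theorem isAccessible_iff {A : HDA.{u, v}} :
    A.IsAccessible ↔ ∀ a, (A.traces A.init a).Nonempty :=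
  forall_congr' fun _ => Set.range_nonempty_iff_nonempty.symm

theorem isCoaccessible_iff {A : HDA.{u, v}} :
    A.IsCoaccessible ↔ ∀ a, ∃ b ∈ A.final, (A.traces a b).Nonempty :=
  forall_congr' fun _ => exists_congr fun _ => and_congr_right fun _ =>
    Set.range_nonempty_iff_nonempty.symm

/-- A relation that is preserved when a trace is extended by an edge is preserved when it is
extended by a path. -/
theorem traces_induction (A : HDA.{u, v}) {C : A.alphabet.TraceMonoid → A.P.cube 0 → Prop}
    (h : ∀ m x, C m (A.P.d 0 0 x) → C (m * A.alphabet.trace (A.label x)) (A.P.d 1 0 x))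
    {a b : A.P.cube 0} {n : A.alphabet.TraceMonoid} (hn : n ∈ A.traces a b)
    {m : A.alphabet.TraceMonoid} (hm : C m a) : C (m * n) b := by
  obtain ⟨ω, rfl⟩ := hn
  induction ω generalizing m with
  | nil a => exact (congrArg (C · a) ((congrArg (m * ·) (map_one _)).trans (mul_one m))).mpr hm
  | cons x hx ω ih =>
    subst hx
    have := ih (h m x hm)
    rwa [mul_assoc, ← map_mul] at this

/-- A morphism of precubical sets that is compatible with the labels maps traces of paths to traces
of paths. -/
theorem map_mem_traces {A : HDA.{u, v}} {B : HDA.{u', v'}} (φ : Hom A.P B.P)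
    (f : A.alphabet.TraceMonoid →* B.alphabet.TraceMonoid)
    (hf : ∀ x, B.alphabet.trace (B.label (φ.toFun x)) = f (A.alphabet.trace (A.label x)))
    {a b : A.P.cube 0} {m : A.alphabet.TraceMonoid} (hm : m ∈ A.traces a b) :
    f m ∈ B.traces (φ.toFun a) (φ.toFun b) := by
  refine (congrArg (· ∈ _) (congrArg f (one_mul m))).mp
    (A.traces_induction (C := fun m c => f m ∈ B.traces (φ.toFun a) (φ.toFun c)) ?_ hm ?_)
  · intro m x h
    rw [map_mul, φ.map_d]
    rw [φ.map_d] at h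
    refine mul_mem_traces h ?_
    rw [← hf]
    exact B.label_mem_traces _
  · rw [map_one]
    exact one_mem_traces _ _

/-! ### Paths in a tensor product -/

section tensor

variable (A : HDA.{u, v}) (B : HDA.{u', v'})

theorem trace_map_inl_tensor (m : FreeMonoid A.alphabet.carrier) :
    (A.alphabet.tensor B.alphabet).trace (FreeMonoid.map Sum.inl m) =
      tensorTraceInl A.alphabet B.alphabet (A.alphabet.trace m) := by
  refine DFunLike.congr_fun (f := ((A.alphabet.tensor B.alphabet).trace).comp
    (FreeMonoid.map Sum.inl)) (g := (tensorTraceInl _ _).comp A.alphabet.trace) ?_ m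
  exact FreeMonoid.hom_eq fun a => (tensorTraceInl_letter a).symm

theorem trace_map_inr_tensor (m : FreeMonoid B.alphabet.carrier) :
    (A.alphabet.tensor B.alphabet).trace (FreeMonoid.map Sum.inr m) =
      tensorTraceInr A.alphabet B.alphabet (B.alphabet.trace m) := by
  refine DFunLike.congr_fun (f := ((A.alphabet.tensor B.alphabet).trace).comp
    (FreeMonoid.map Sum.inr)) (g := (tensorTraceInr _ _).comp B.alphabet.trace) ?_ m
  exact FreeMonoid.hom_eq fun a => (tensorTraceInr_letter a).symm

variable {A B}

theorem inl_mem_traces_tensor {a a' : A.P.cube 0} (b : B.P.cube 0) {m : A.alphabet.TraceMonoid}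
    (hm : m ∈ A.traces a a') : tensorTraceInl A.alphabet B.alphabet m ∈
      (A.tensor B).traces (tensorMk rfl a b) (tensorMk rfl a' b) :=
  map_mem_traces (B := A.tensor B) (tensorInl A.P b) (tensorTraceInl A.alphabet B.alphabet)
    (fun x => trace_map_inl_tensor A B (A.label x)) hm

theorem inr_mem_traces_tensor (a : A.P.cube 0) {b b' : B.P.cube 0} {m : B.alphabet.TraceMonoid}
    (hm : m ∈ B.traces b b') : tensorTraceInr A.alphabet B.alphabet m ∈
      (A.tensor B).traces (tensorMk rfl a b) (tensorMk rfl a b') :=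
  map_mem_traces (B := A.tensor B) (tensorInr B.P a) (tensorTraceInr A.alphabet B.alphabet)
    (fun y => trace_map_inr_tensor A B (B.label y)) hm

/-- An edge of the tensor product moves one coordinate along an edge and fixes the other;
correspondingly, one projection of its trace is the label of that edge and the other is trivial. -/
theorem fst_mem_traces {c c' : (A.P.tensor B.P).cube 0}
    {m : (A.alphabet.tensor B.alphabet).TraceMonoid} (hm : m ∈ (A.tensor B).traces c c') :
    tensorTraceFst A.alphabet B.alphabet m ∈ A.traces (vertexFst c) (vertexFst c') ∧
      tensorTraceSnd A.alphabet B.alphabet m ∈ B.traces (vertexSnd c) (vertexSnd c') := by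
  let C (m : (A.alphabet.tensor B.alphabet).TraceMonoid) (d : (A.P.tensor B.P).cube 0) : Prop :=
    tensorTraceFst A.alphabet B.alphabet m ∈ A.traces (vertexFst c) (vertexFst d) ∧
      tensorTraceSnd A.alphabet B.alphabet m ∈ B.traces (vertexSnd c) (vertexSnd d)
  refine (congrArg (C · c') (one_mul m)).mp ((A.tensor B).traces_induction (C := C) ?_ hm ?_)
  · rintro m x ⟨h1, h2⟩
    obtain ⟨x, b, rfl⟩ | ⟨a, y, rfl⟩ := exists_eq_tensorMk_one x
    · have hx : (A.tensor B).alphabet.trace ((A.tensor B).label (tensorMk rfl x b)) =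
        tensorTraceInl A.alphabet B.alphabet (A.alphabet.trace (A.label x)) :=
        trace_map_inl_tensor A B (A.label x)
      rw [hx]
      refine ⟨?_, ?_⟩
      · refine (congrArg (· ∈ _) (map_mul (tensorTraceFst A.alphabet B.alphabet) _ _)).mpr ?_
        rw [tensorTraceFst_inl]
        exact mul_mem_traces h1 (A.label_mem_traces x)
      · refine (congrArg (· ∈ _) (map_mul (tensorTraceSnd A.alphabet B.alphabet) _ _)).mpr ?_
        rw [tensorTraceSnd_inl, mul_one]
        exact h2
    · have hy : (A.tensor B).alphabet.trace ((A.tensor B).label (tensorMk rfl a y)) =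
        tensorTraceInr A.alphabet B.alphabet (B.alphabet.trace (B.label y)) :=
        trace_map_inr_tensor A B (B.label y)
      rw [hy]
      refine ⟨?_, ?_⟩
      · refine (congrArg (· ∈ _) (map_mul (tensorTraceFst A.alphabet B.alphabet) _ _)).mpr ?_
        rw [tensorTraceFst_inr, mul_one]
        exact h1
      · refine (congrArg (· ∈ _) (map_mul (tensorTraceSnd A.alphabet B.alphabet) _ _)).mpr ?_
        rw [tensorTraceSnd_inr]
        exact mul_mem_traces h2 (B.label_mem_traces y)
  · exact ⟨(congrArg (· ∈ _) (map_one _)).mpr (one_mem_traces _ _),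
      (congrArg (· ∈ _) (map_one _)).mpr (one_mem_traces _ _)⟩

/-- Conversely, first run through the path in `A`, then through the one in `B`; by `tensorTrace_eq`
the resulting trace does not depend on how the two are interleaved. -/
theorem mem_traces_tensor_iff {c c' : (A.P.tensor B.P).cube 0}
    {m : (A.alphabet.tensor B.alphabet).TraceMonoid} : m ∈ (A.tensor B).traces c c' ↔
    tensorTraceFst A.alphabet B.alphabet m ∈ A.traces (vertexFst c) (vertexFst c') ∧
      tensorTraceSnd A.alphabet B.alphabet m ∈ B.traces (vertexSnd c) (vertexSnd c') := by
  refine ⟨fst_mem_traces, fun ⟨h1, h2⟩ => ?_⟩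
  have h := mul_mem_traces (inl_mem_traces_tensor (vertexSnd c) h1)
    (inr_mem_traces_tensor (vertexFst c') h2)
  rw [tensorMk_vertex, tensorMk_vertex] at h
  exact (congrArg (· ∈ _) (tensorTrace_eq m)).mp h

variable (A B)

theorem fundamentalMonoid_tensor : (A.tensor B).fundamentalMonoid =
    tensorFM A.alphabet B.alphabet A.fundamentalMonoid B.fundamentalMonoid :=
  Submonoid.ext fun _ => mem_traces_tensor_iff

theorem traceLanguage_tensor : (A.tensor B).traceLanguage =
    tensorTL A.alphabet B.alphabet A.traceLanguage B.traceLanguage := by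
  ext m
  constructor
  · intro h
    obtain ⟨c, r, h⟩ := mem_traceLanguage_iff.mp h
    obtain ⟨h1, h2⟩ := mem_traces_tensor_iff.mp h
    exact ⟨mem_traceLanguage_iff.mpr ⟨_, _, (congrArg (· ∈ _)
        (map_mul (tensorTraceFst A.alphabet B.alphabet) _ _)).mp h1⟩,
      mem_traceLanguage_iff.mpr ⟨_, _, (congrArg (· ∈ _)
        (map_mul (tensorTraceSnd A.alphabet B.alphabet) _ _)).mp h2⟩⟩
  · rintro ⟨h1, h2⟩
    obtain ⟨a, r, h1⟩ := mem_traceLanguage_iff.mp h1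
    obtain ⟨b, s, h2⟩ := mem_traceLanguage_iff.mp h2
    -- The product of the two remainders completes both projections at once.
    refine mem_traceLanguage_iff.mpr ⟨tensorMk rfl a b, tensorTraceInl A.alphabet B.alphabet r *
      tensorTraceInr A.alphabet B.alphabet s, mem_traces_tensor_iff.mpr ⟨?_, ?_⟩⟩
    · refine (congrArg (· ∈ _) ?_).mpr h1
      refine (map_mul (tensorTraceFst A.alphabet B.alphabet) _ _).trans (congrArg (_ * ·) ?_)
      rw [map_mul, tensorTraceFst_inl, tensorTraceFst_inr, mul_one]
    · refine (congrArg (· ∈ _) ?_).mpr h2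
      refine (map_mul (tensorTraceSnd A.alphabet B.alphabet) _ _).trans (congrArg (_ * ·) ?_)
      rw [map_mul, tensorTraceSnd_inl, tensorTraceSnd_inr, one_mul]

theorem isAccessible_tensor_iff : (A.tensor B).IsAccessible ↔ A.IsAccessible ∧ B.IsAccessible := by
  simp only [isAccessible_iff]
  constructor
  · intro h
    refine ⟨fun a => ?_, fun b => ?_⟩
    · obtain ⟨m, hm⟩ := h (tensorMk rfl a B.init)
      exact ⟨_, (mem_traces_tensor_iff.mp hm).1⟩
    · obtain ⟨m, hm⟩ := h (tensorMk rfl A.init b)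
      exact ⟨_, (mem_traces_tensor_iff.mp hm).2⟩
  · refine fun ⟨hA, hB⟩ (c : (A.P.tensor B.P).cube 0) => ?_
    obtain ⟨m, hm⟩ := hA (vertexFst c)
    obtain ⟨n, hn⟩ := hB (vertexSnd c)
    have h := mul_mem_traces (inl_mem_traces_tensor B.init hm)
      (inr_mem_traces_tensor (vertexFst c) hn)
    rw [tensorMk_vertex] at h
    exact ⟨_, h⟩

theorem isCoaccessible_tensor_iff :
    (A.tensor B).IsCoaccessible ↔ A.IsCoaccessible ∧ B.IsCoaccessible := by
  simp only [isCoaccessible_iff]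
  constructor
  · intro h
    refine ⟨fun a => ?_, fun b => ?_⟩
    · obtain ⟨_, ⟨a', ha', b', -, rfl⟩, m, hm⟩ := h (tensorMk rfl a B.init)
      exact ⟨a', ha', _, (mem_traces_tensor_iff.mp hm).1⟩
    · obtain ⟨_, ⟨a', -, b', hb', rfl⟩, m, hm⟩ := h (tensorMk rfl A.init b)
      exact ⟨b', hb', _, (mem_traces_tensor_iff.mp hm).2⟩
  · refine fun ⟨hA, hB⟩ (c : (A.P.tensor B.P).cube 0) => ?_
    obtain ⟨a, ha, m, hm⟩ := hA (vertexFst c)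
    obtain ⟨b, hb, n, hn⟩ := hB (vertexSnd c)
    have h := mul_mem_traces (inl_mem_traces_tensor (vertexSnd c) hm)
      (inr_mem_traces_tensor a hn)
    rw [tensorMk_vertex] at h
    exact ⟨tensorMk rfl a b, ⟨a, ha, b, hb, rfl⟩, _, h⟩

end tensor

/-! ### Paths in a coproduct -/

section coprod

variable (A : HDA.{u, v}) (B : HDA.{u', v'})

theorem trace_map_inl_coprod (m : FreeMonoid A.alphabet.carrier) :
    (A.alphabet.coprod B.alphabet).trace (FreeMonoid.map Sum.inl m) =
      coprodTraceInl A.alphabet B.alphabet (A.alphabet.trace m) := by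
  refine DFunLike.congr_fun (f := ((A.alphabet.coprod B.alphabet).trace).comp
    (FreeMonoid.map Sum.inl)) (g := (coprodTraceInl _ _).comp A.alphabet.trace) ?_ m
  exact FreeMonoid.hom_eq fun a => (coprodTraceInl_letter a).symm

theorem trace_map_inr_coprod (m : FreeMonoid B.alphabet.carrier) :
    (A.alphabet.coprod B.alphabet).trace (FreeMonoid.map Sum.inr m) =
      coprodTraceInr A.alphabet B.alphabet (B.alphabet.trace m) := by
  refine DFunLike.congr_fun (f := ((A.alphabet.coprod B.alphabet).trace).comp
    (FreeMonoid.map Sum.inr)) (g := (coprodTraceInr _ _).comp B.alphabet.trace) ?_ m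
  exact FreeMonoid.hom_eq fun a => (coprodTraceInr_letter a).symm

variable {A B}

theorem inl_mem_traces_coprod {a a' : A.P.cube 0} {m : A.alphabet.TraceMonoid}
    (hm : m ∈ A.traces a a') : coprodTraceInl A.alphabet B.alphabet m ∈
      (A.coprod B).traces ((coprodInl A B).toFun a) ((coprodInl A B).toFun a') :=
  map_mem_traces (B := A.coprod B) (coprodInl A B) (coprodTraceInl A.alphabet B.alphabet)
    (fun x => trace_map_inl_coprod A B (A.label x)) hm

theorem inr_mem_traces_coprod {b b' : B.P.cube 0} {m : B.alphabet.TraceMonoid}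
    (hm : m ∈ B.traces b b') : coprodTraceInr A.alphabet B.alphabet m ∈
      (A.coprod B).traces ((coprodInr A B).toFun b) ((coprodInr A B).toFun b') :=
  map_mem_traces (B := A.coprod B) (coprodInr A B) (coprodTraceInr A.alphabet B.alphabet)
    (fun y => trace_map_inr_coprod A B (B.label y)) hm

variable (A B) in
/-- The trace is that of some loops at the initial state, followed by a path to the vertex in one of
the two summands. -/
def IsCoprodTrace (m : (A.alphabet.coprod B.alphabet).TraceMonoid) (c : (A.coprod B).P.cube 0) :
    Prop :=
  ∃ n ∈ coprodFM A.alphabet B.alphabet A.fundamentalMonoid B.fundamentalMonoid,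
    (∃ t ∈ A.traces A.init (vertexFst c.1), vertexSnd c.1 = B.init ∧
      m = n * coprodTraceInl A.alphabet B.alphabet t) ∨
    ∃ t ∈ B.traces B.init (vertexSnd c.1), vertexFst c.1 = A.init ∧
      m = n * coprodTraceInr A.alphabet B.alphabet t

/-- If the last block lies in `B`, it is a loop at the initial state of `B`. It can be moved into
the submonoid generated by loops, which leaves an empty block in `A`. -/
theorem IsCoprodTrace.exists_inl {m : (A.alphabet.coprod B.alphabet).TraceMonoid}
    {c : (A.coprod B).P.cube 0} (h : IsCoprodTrace A B m c) (hc : vertexSnd c.1 = B.init) :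
    ∃ n ∈ coprodFM A.alphabet B.alphabet A.fundamentalMonoid B.fundamentalMonoid,
      ∃ t ∈ A.traces A.init (vertexFst c.1), m = n * coprodTraceInl A.alphabet B.alphabet t := by
  obtain ⟨n, hn, ⟨t, ht, -, rfl⟩ | ⟨t, ht, hc', rfl⟩⟩ := h
  · exact ⟨n, hn, t, ht, rfl⟩
  · rw [hc] at ht
    rw [hc']
    exact ⟨_, mul_mem hn (Submonoid.mem_sup_right ⟨t, ht, rfl⟩), 1, one_mem_traces _ _,
      by rw [map_one, mul_one]⟩

theorem IsCoprodTrace.exists_inr {m : (A.alphabet.coprod B.alphabet).TraceMonoid}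
    {c : (A.coprod B).P.cube 0} (h : IsCoprodTrace A B m c) (hc : vertexFst c.1 = A.init) :
    ∃ n ∈ coprodFM A.alphabet B.alphabet A.fundamentalMonoid B.fundamentalMonoid,
      ∃ t ∈ B.traces B.init (vertexSnd c.1), m = n * coprodTraceInr A.alphabet B.alphabet t := by
  obtain ⟨n, hn, ⟨t, ht, hc', rfl⟩ | ⟨t, ht, -, rfl⟩⟩ := h
  · rw [hc] at ht
    rw [hc']
    exact ⟨_, mul_mem hn (Submonoid.mem_sup_left ⟨t, ht, rfl⟩), 1, one_mem_traces _ _,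
      by rw [map_one, mul_one]⟩
  · exact ⟨n, hn, t, ht, rfl⟩

/-- The start of an edge of one summand has the initial state as its other coordinate, so the last
block may be taken in the summand of that edge, which then extends it. -/
theorem isCoprodTrace_of_mem_traces {c : (A.coprod B).P.cube 0}
    {m : (A.alphabet.coprod B.alphabet).TraceMonoid}
    (hm : m ∈ (A.coprod B).traces (A.coprod B).init c) : IsCoprodTrace A B m c := by
  refine (congrArg (IsCoprodTrace A B · c) (one_mul m)).mp
    ((A.coprod B).traces_induction (C := IsCoprodTrace A B) ?_ hm ?_)
  · rintro m ⟨_, ⟨x, rfl⟩ | ⟨y, rfl⟩⟩ h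
    · obtain ⟨n, hn, t, ht, rfl⟩ := h.exists_inl rfl
      refine ⟨n, hn, .inl ⟨_, mul_mem_traces ht (A.label_mem_traces x), rfl, ?_⟩⟩
      rw [map_mul, ← mul_assoc]
      exact congrArg (_ * ·) (trace_map_inl_coprod A B (A.label x))
    · obtain ⟨n, hn, t, ht, rfl⟩ := h.exists_inr rfl
      refine ⟨n, hn, .inr ⟨_, mul_mem_traces ht (B.label_mem_traces y), rfl, ?_⟩⟩
      rw [map_mul, ← mul_assoc]
      exact congrArg (_ * ·) (trace_map_inr_coprod A B (B.label y))
  · exact ⟨1, one_mem _, .inl ⟨1, one_mem_traces _ _, rfl, by rw [map_one, mul_one]⟩⟩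

variable (A B)

theorem coprodFM_le_fundamentalMonoid_coprod :
    coprodFM A.alphabet B.alphabet A.fundamentalMonoid B.fundamentalMonoid ≤
      (A.coprod B).fundamentalMonoid := by
  refine sup_le ?_ ?_
  · rintro _ ⟨u, hu, rfl⟩
    exact inl_mem_traces_coprod hu
  · rintro _ ⟨u, hu, rfl⟩
    exact inr_mem_traces_coprod hu

/-- For a loop, the last block is itself a loop and so belongs to the generated submonoid. -/
theorem fundamentalMonoid_coprod : (A.coprod B).fundamentalMonoid =
    coprodFM A.alphabet B.alphabet A.fundamentalMonoid B.fundamentalMonoid := by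
  refine le_antisymm (fun m hm => ?_) (coprodFM_le_fundamentalMonoid_coprod A B)
  obtain ⟨n, hn, t, ht, rfl⟩ := (isCoprodTrace_of_mem_traces hm).exists_inl rfl
  exact mul_mem hn (Submonoid.mem_sup_left ⟨t, ht, rfl⟩)

theorem traceLanguage_coprod : (A.coprod B).traceLanguage =
    coprodTL A.alphabet B.alphabet A.fundamentalMonoid B.fundamentalMonoid A.traceLanguage
      B.traceLanguage := by
  ext m
  constructor
  · intro h
    obtain ⟨c, r, h⟩ := mem_traceLanguage_iff.mp h
    -- The full path has the required form by `isCoprodTrace_of_mem_traces`; `m` is only a prefix of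
    -- its trace.
    refine mem_coprodTL_of_mul_mem (r := r) mem_traceLanguage_of_mul_mem
      mem_traceLanguage_of_mul_mem mul_mem_traceLanguage mul_mem_traceLanguage
      (fun _ => mem_traceLanguage_of_mem_traces) (fun _ => mem_traceLanguage_of_mem_traces) ?_
    obtain ⟨n, hn, ⟨t, ht, -, h⟩ | ⟨t, ht, -, h⟩⟩ := isCoprodTrace_of_mem_traces h
    · exact ⟨n, hn, .inl ⟨t, mem_traceLanguage_of_mem_traces ht, h⟩⟩
    · exact ⟨n, hn, .inr ⟨t, mem_traceLanguage_of_mem_traces ht, h⟩⟩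
  · rintro ⟨n, hn, ⟨t, ht, rfl⟩ | ⟨t, ht, rfl⟩⟩
    · obtain ⟨b, r, h⟩ := mem_traceLanguage_iff.mp ht
      refine mul_mem_traceLanguage (A := A.coprod B) n
        (coprodFM_le_fundamentalMonoid_coprod A B hn) _ (mem_traceLanguage_iff.mpr
          ⟨_, coprodTraceInl A.alphabet B.alphabet r, (congrArg (· ∈ _) ?_).mp
            (inl_mem_traces_coprod h)⟩)
      exact map_mul _ _ _
    · obtain ⟨b, r, h⟩ := mem_traceLanguage_iff.mp ht
      refine mul_mem_traceLanguage (A := A.coprod B) n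
        (coprodFM_le_fundamentalMonoid_coprod A B hn) _ (mem_traceLanguage_iff.mpr
          ⟨_, coprodTraceInr A.alphabet B.alphabet r, (congrArg (· ∈ _) ?_).mp
            (inr_mem_traces_coprod h)⟩)
      exact map_mul _ _ _

theorem isAccessible_coprod_iff : (A.coprod B).IsAccessible ↔ A.IsAccessible ∧ B.IsAccessible := by
  simp only [isAccessible_iff]
  constructor
  · intro h
    refine ⟨fun a => ?_, fun b => ?_⟩
    · obtain ⟨m, hm⟩ := h ((coprodInl A B).toFun a)
      -- The last block is the trace of a path to `a` inside `A`.
      obtain ⟨_, _, t, ht, _⟩ := (isCoprodTrace_of_mem_traces hm).exists_inl rfl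
      exact ⟨t, ht⟩
    · obtain ⟨m, hm⟩ := h ((coprodInr A B).toFun b)
      obtain ⟨_, _, t, ht, _⟩ := (isCoprodTrace_of_mem_traces hm).exists_inr rfl
      exact ⟨t, ht⟩
  · rintro ⟨hA, hB⟩ ⟨_, ⟨a, rfl⟩ | ⟨b, rfl⟩⟩
    · obtain ⟨m, hm⟩ := hA a
      exact ⟨_, inl_mem_traces_coprod (B := B) hm⟩
    · obtain ⟨m, hm⟩ := hB b
      exact ⟨_, inr_mem_traces_coprod (A := A) hm⟩

/-- The converse fails: a state of `A` may reach a final state of `B` through the common initial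
state. This is why coaccessibility of both automata is assumed for the coproduct. -/
theorem IsCoaccessible.coprod {A : HDA.{u, v}} {B : HDA.{u', v'}} (hA : A.IsCoaccessible)
    (hB : B.IsCoaccessible) : (A.coprod B).IsCoaccessible := by
  rw [isCoaccessible_iff] at *
  rintro ⟨_, ⟨a, rfl⟩ | ⟨b, rfl⟩⟩
  · obtain ⟨a', ha', m, hm⟩ := hA a
    exact ⟨_, .inl ⟨a', ha', rfl⟩, _, inl_mem_traces_coprod (B := B) hm⟩
  · obtain ⟨b', hb', m, hm⟩ := hB b
    exact ⟨_, .inr ⟨b', hb', rfl⟩, _, inr_mem_traces_coprod (A := A) hm⟩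

end coprod

/-! ### Monotonicity -/

section mono

variable {S S' : ConcurrentAlphabet.{v}} {T T' : ConcurrentAlphabet.{v'}}

/-- Here and below the alphabets are variables rather than fields of automata, so that their
equalities can be substituted and the transports disappear. This is what the formulas in terms of
invariants alone are for. -/
theorem tensorFM_mono (hS : S = S') (hT : T = T') (h : S.tensor T = S'.tensor T')
    {M : Submonoid S.TraceMonoid} {M' : Submonoid S'.TraceMonoid} {N : Submonoid T.TraceMonoid}
    {N' : Submonoid T'.TraceMonoid} (hM : (hS ▸ M : Submonoid S'.TraceMonoid) ≤ M')
    (hN : (hT ▸ N : Submonoid T'.TraceMonoid) ≤ N') :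
    (h ▸ tensorFM S T M N : Submonoid (S'.tensor T').TraceMonoid) ≤ tensorFM S' T' M' N' := by
  subst hS hT
  exact inf_le_inf (Submonoid.monotone_comap hM) (Submonoid.monotone_comap hN)

theorem tensorTL_mono (hS : S = S') (hT : T = T') (h : S.tensor T = S'.tensor T')
    {X : Set S.TraceMonoid} {X' : Set S'.TraceMonoid} {Y : Set T.TraceMonoid}
    {Y' : Set T'.TraceMonoid} (hX : (hS ▸ X : Set S'.TraceMonoid) ⊆ X')
    (hY : (hT ▸ Y : Set T'.TraceMonoid) ⊆ Y') :
    (h ▸ tensorTL S T X Y : Set (S'.tensor T').TraceMonoid) ⊆ tensorTL S' T' X' Y' := by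
  subst hS hT
  exact fun m hm => ⟨hX hm.1, hY hm.2⟩

theorem tensorHL_mono (R : Type w) [CommRing R] (hS : S = S') (hT : T = T')
    (h : S.tensor T = S'.tensor T') {U : ℕ → Submodule R (S.Ext R)}
    {U' : ℕ → Submodule R (S'.Ext R)} {V : ℕ → Submodule R (T.Ext R)}
    {V' : ℕ → Submodule R (T'.Ext R)} (hU : ∀ n, (hS ▸ U n : Submodule R (S'.Ext R)) ≤ U' n)
    (hV : ∀ n, (hT ▸ V n : Submodule R (T'.Ext R)) ≤ V' n) (n : ℕ) :
    (h ▸ tensorHL R S T U V n : Submodule R ((S'.tensor T').Ext R)) ≤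
      tensorHL R S' T' U' V' n := by
  subst hS hT
  exact iSup_mono fun pq => mul_le_mul' (Submodule.map_mono (hU _)) (Submodule.map_mono (hV _))

theorem coprodFM_mono (hS : S = S') (hT : T = T') (h : S.coprod T = S'.coprod T')
    {M : Submonoid S.TraceMonoid} {M' : Submonoid S'.TraceMonoid} {N : Submonoid T.TraceMonoid}
    {N' : Submonoid T'.TraceMonoid} (hM : (hS ▸ M : Submonoid S'.TraceMonoid) ≤ M')
    (hN : (hT ▸ N : Submonoid T'.TraceMonoid) ≤ N') :
    (h ▸ coprodFM S T M N : Submonoid (S'.coprod T').TraceMonoid) ≤ coprodFM S' T' M' N' := by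
  subst hS hT
  exact sup_le_sup (Submonoid.monotone_map hM) (Submonoid.monotone_map hN)

theorem coprodTL_mono (hS : S = S') (hT : T = T') (h : S.coprod T = S'.coprod T')
    {M : Submonoid S.TraceMonoid} {M' : Submonoid S'.TraceMonoid} {N : Submonoid T.TraceMonoid}
    {N' : Submonoid T'.TraceMonoid} (hM : (hS ▸ M : Submonoid S'.TraceMonoid) ≤ M')
    (hN : (hT ▸ N : Submonoid T'.TraceMonoid) ≤ N')
    {X : Set S.TraceMonoid} {X' : Set S'.TraceMonoid} {Y : Set T.TraceMonoid}
    {Y' : Set T'.TraceMonoid} (hX : (hS ▸ X : Set S'.TraceMonoid) ⊆ X')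
    (hY : (hT ▸ Y : Set T'.TraceMonoid) ⊆ Y') :
    (h ▸ coprodTL S T M N X Y : Set (S'.coprod T').TraceMonoid) ⊆ coprodTL S' T' M' N' X' Y' := by
  subst hS hT
  rintro m ⟨n, hn, H⟩
  refine ⟨n, sup_le_sup (Submonoid.monotone_map hM) (Submonoid.monotone_map hN) hn, H.imp ?_ ?_⟩
  · exact fun ⟨t, ht, e⟩ => ⟨t, hX ht, e⟩
  · exact fun ⟨t, ht, e⟩ => ⟨t, hY ht, e⟩

theorem coprodHL_mono (R : Type w) [CommRing R] (hS : S = S') (hT : T = T')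
    (h : S.coprod T = S'.coprod T') {U : ℕ → Submodule R (S.Ext R)}
    {U' : ℕ → Submodule R (S'.Ext R)} {V : ℕ → Submodule R (T.Ext R)}
    {V' : ℕ → Submodule R (T'.Ext R)} (hU : ∀ n, (hS ▸ U n : Submodule R (S'.Ext R)) ≤ U' n)
    (hV : ∀ n, (hT ▸ V n : Submodule R (T'.Ext R)) ≤ V' n) (n : ℕ) :
    (h ▸ coprodHL R S T U V n : Submodule R ((S'.coprod T').Ext R)) ≤
      coprodHL R S' T' U' V' n := by
  subst hS hT
  exact sup_le_sup (Submodule.map_mono (hU _)) (Submodule.map_mono (hV _))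

end mono

theorem WeaklyImplements.tensor {R : Type w} [CommRing R] [IsDomain R] [IsPrincipalIdealRing R]
    {A : HDA.{u₁, v₁}} {A' : HDA.{u₂, v₁}} {B : HDA.{u₃, v₂}} {B' : HDA.{u₄, v₂}}
    (hA : A.WeaklyImplements R A') (hB : B.WeaklyImplements R B') :
    (A.tensor B).WeaklyImplements R (A'.tensor B') := by
  obtain ⟨hA1, hA2, hS, hA3, hA4, hA5⟩ := hA
  obtain ⟨hB1, hB2, hT, hB3, hB4, hB5⟩ := hB
  have h : A.alphabet.tensor B.alphabet = A'.alphabet.tensor B'.alphabet := by rw [hS, hT]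
  refine ⟨?_, ?_, h, ?_, ?_, fun n => ?_⟩
  · rw [isAccessible_tensor_iff, isAccessible_tensor_iff]
    exact And.imp hA1 hB1
  · rw [isCoaccessible_tensor_iff, isCoaccessible_tensor_iff]
    exact And.imp hA2 hB2
  · rw [fundamentalMonoid_tensor, fundamentalMonoid_tensor]
    exact tensorFM_mono hS hT h hA3 hB3
  · rw [traceLanguage_tensor, traceLanguage_tensor]
    exact tensorTL_mono hS hT h hA4 hB4
  · rw [homologyLanguage_tensor, homologyLanguage_tensor]
    exact tensorHL_mono R hS hT h hA5 hB5 n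

theorem WeaklyImplements.coprod {R : Type w} [CommRing R]
    {A : HDA.{u₁, v₁}} {A' : HDA.{u₂, v₁}} {B : HDA.{u₃, v₂}} {B' : HDA.{u₄, v₂}}
    (hA : A.WeaklyImplements R A') (hB : B.WeaklyImplements R B') (hAc : A.IsCoaccessible)
    (hBc : B.IsCoaccessible) : (A.coprod B).WeaklyImplements R (A'.coprod B') := by
  obtain ⟨hA1, -, hS, hA3, hA4, hA5⟩ := hA
  obtain ⟨hB1, -, hT, hB3, hB4, hB5⟩ := hB
  have h : A.alphabet.coprod B.alphabet = A'.alphabet.coprod B'.alphabet := by rw [hS, hT]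
  -- Coaccessibility comes from `A` and `B` themselves, as that of `A' + B'` says nothing definite
  -- about `A'` and `B'` separately.
  refine ⟨?_, fun _ => hAc.coprod hBc, h, ?_, ?_, fun n => ?_⟩
  · rw [isAccessible_coprod_iff, isAccessible_coprod_iff]
    exact And.imp hA1 hB1
  · rw [fundamentalMonoid_coprod, fundamentalMonoid_coprod]
    exact coprodFM_mono hS hT h hA3 hB3
  · rw [traceLanguage_coprod, traceLanguage_coprod]
    exact coprodTL_mono hS hT h hA3 hB3 hA4 hB4
  · rw [homologyLanguage_coprod, homologyLanguage_coprod]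
    exact coprodHL_mono R hS hT h hA5 hB5 n

end HDA

end

theorem mainTheorem1 (R : Type r) [CommRing R] [IsDomain R]
    [IsPrincipalIdealRing R] (A : HDA.{u₁, v₁}) (A' : HDA.{u₂, v₁}) (B : HDA.{u₃, v₂})
    (B' : HDA.{u₄, v₂}) (hA : A.WeaklyImplements R A') (hB : B.WeaklyImplements R B') :
    (A.tensor B).WeaklyImplements R (A'.tensor B') ∧
      (A.IsCoaccessible → B.IsCoaccessible →
        (A.coprod B).WeaklyImplements R (A'.coprod B')) := by
  exact ⟨hA.tensor hB, hA.coprod hB⟩
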